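/- Let $n\ge 3$ be an odd integer. For a reciprocal polynomial $f\in\mathbb{Z}[x]$ of degree $2n$ (that is, $x^{2n}f(1/x)=f(x)$), let $g\in\mathbb{Z}[u]$ be the unique polynomial of degree $n$ with $f(x)=x^n g(x+1/x)$. Let $G_f$ and $G_g$ be the Galois groups over $\mathbb{Q}$ of $f$ and $g$, regarded as permutation groups of their complex roots. If $f$ is separable, its $2n$ roots fall into $n$ pairs $\{\alpha_i,1/\alpha_i\}$, and $G_f$ is a subgroup, well defined up to conjugation, of the group $S_2\wr S_n=\mathbb{F}_2^n\rtimes S_n$ of permutations of the roots preserving this partition into pairs. Let $$G_3=\langle\mathbf{1}\rangle\times S_n=\{(\mathbf{v},\sigma)\in\mathbb{F}_2^n\rtimes S_n:\ \mathbf{v}=(0,\dots,0)\text{ or }\mathbf{v}=(1,\dots,1)\}.$$ For real $H\ge 2$ let $\mathcal{E}_n(G_3;H)$ be the number of separable reciprocal polynomials $f\in\mathbb{Z}[x]$ of degree $2n$ with all coefficients in $[-H,H]$ such that $G_g=S_n$ and $G_f$ is conjugate in $S_2\wr S_n$ to a subgroup of $G_3$, and let $\mathcal{E}_n^{\mathrm{monic}}(G_3;H)$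 be the number of those $f$ that are monic. Then, as $H\to\infty$, $$\mathcal{E}_n(G_3;H)\ll\begin{cases}H^2\log^2 H, & n=3,\\ H^{\frac{n+1}{2}}, & n\ge 5,\end{cases}\qquad \mathcal{E}_n^{\mathrm{monic}}(G_3;H)\ll\begin{cases}H^2, & n=3,\\ H^2\log H\,\log\log H, & n=5,\\ H^{\frac{n-1}{2}}\log H, & n\ge 7.\end{cases}$$ Here $A(H)\ll B(H)$ means that there is a constant $c$, depending only on $n$, with $|A(H)|\le c\,|B(H)|$ for all sufficiently large real $H$. -/

import Mathlib

open Polynomial Filter Asymptotics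

namespace ReciprocalGalois

noncomputable section

/-! ### The wreath product `S₂ ≀ Sₙ = 𝔽₂ⁿ ⋊ Sₙ` and its subgroup `G₃` -/

/-- The group with two elements, written multiplicatively; it plays the role of `𝔽₂ = S₂`. -/
abbrev S2 : Type := Multiplicative (ZMod 2)

/-- The nontrivial element of `S₂`. -/
def flip : S2 := Multiplicative.ofAdd 1

/-- The wreath product `S₂ ≀ Sₙ = 𝔽₂ⁿ ⋊ Sₙ`, where `Sₙ` permutes the `n` coordinates:
`(σ v) i = v (σ⁻¹ i)`. -/
abbrev Wreath (n : ℕ) : Type :=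
  (Fin n → S2) ⋊[(mulAutArrow : Equiv.Perm (Fin n) →* MulAut (Fin n → S2))] Equiv.Perm (Fin n)

/-- The subgroup `G₃ = ⟨𝟏⟩ × Sₙ` of `S₂ ≀ Sₙ`: the pairs `(v, σ)` with `v = (0, …, 0)` or
`v = (1, …, 1)`. -/
def G3 (n : ℕ) : Subgroup (Wreath n) where
  carrier := {w | ∃ c : S2, w.left = fun _ => c}
  one_mem' := ⟨1, rfl⟩
  mul_mem' := by
    rintro a b ⟨c, hc⟩ ⟨d, hd⟩
    refine ⟨c * d, ?_⟩
    funext i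
    simp only [SemidirectProduct.mul_left, hc, hd]
    rfl
  inv_mem' := by
    rintro a ⟨c, hc⟩
    refine ⟨c⁻¹, ?_⟩
    funext i
    simp only [SemidirectProduct.inv_left, hc]
    rfl

/-- The standard action of `S₂ ≀ Sₙ` on the `2n` points of `n` pairs:
`(v, σ)` sends `(i, s)` to `(σ i, v (σ i) * s)`. -/
def Wreath.act {n : ℕ} (w : Wreath n) (p : Fin n × S2) : Fin n × S2 :=
  (w.right p.1, w.left (w.right p.1) * p.2)

theorem Wreath.act_one {n : ℕ} (p : Fin n × S2) : (1 : Wreath n).act p = p := by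
  simp [Wreath.act]

theorem Wreath.act_mul {n : ℕ} (w w' : Wreath n) (p : Fin n × S2) :
    (w * w').act p = w.act (w'.act p) := by
  simp only [Wreath.act, SemidirectProduct.mul_right, SemidirectProduct.mul_left,
    Equiv.Perm.mul_apply, Pi.mul_apply, mul_assoc]
  change (_, w.left _ * (w'.left (w.right⁻¹ (w.right (w'.right p.1))) * p.2)) = _
  simp

/-! ### Reciprocal polynomials and their Galois groups -/

attribute [local instance] Polynomial.Gal.splits_ℚ_ℂ

/-- The polynomial `f`, viewed over `ℚ`. -/
abbrev toRat (f : ℤ[X]) : ℚ[X] := f.map (Int.castRingHom ℚ)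

/-- `f` is a reciprocal polynomial: `x ^ (deg f) * f (1 / x) = f x`, i.e. its list of
coefficients is palindromic. -/
def IsReciprocal (f : ℤ[X]) : Prop := f.reverse = f

/-- `g` is the degree `n` polynomial attached to the reciprocal polynomial `f` of degree `2n`:
`f x = x ^ n * g (x + 1 / x)`. -/
def IsTracePolynomial (n : ℕ) (f g : ℤ[X]) : Prop :=
  g.natDegree = n ∧ ∀ x : ℂ, x ≠ 0 → aeval x f = x ^ n * aeval (x + x⁻¹) g

/-- The Galois group of `g` over `ℚ` is the full symmetric group on the complex roots of `g`. -/
def HasFullSymmetricGalois (g : ℤ[X]) : Prop :=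
  Function.Surjective (Gal.galActionHom (toRat g) ℂ)

/-- A labelling of the roots of `f` as `n` pairs `{α i, 1 / α i}`: the point `(i, s)` labels
a root, and swapping `s` inverts that root. -/
structure RootLabelling (n : ℕ) (f : ℤ[X]) where
  /-- the bijection between labels and roots -/
  toEquiv : Fin n × S2 ≃ (toRat f).rootSet ℂ
  /-- the two members of a pair are inverse to each other -/
  flip_eq_inv : ∀ (i : Fin n) (s : S2),
    (toEquiv (i, flip * s) : ℂ) = (toEquiv (i, s) : ℂ)⁻¹

/-- `G_f ⊆ G` for a subgroup `G` of `S₂ ≀ Sₙ`, up to conjugation: for some labelling of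
the roots of `f` by pairs, every element of the Galois group of `f` over `ℚ` permutes the
roots as some element of `G` permutes the labels. (Changing the labelling amounts to
conjugating in `S₂ ≀ Sₙ`.) -/
def GaloisContainedIn {n : ℕ} (f : ℤ[X]) (G : Subgroup (Wreath n)) : Prop :=
  ∃ ε : RootLabelling n f, ∀ γ : (toRat f).Gal, ∃ w ∈ G, ∀ p : Fin n × S2,
    Gal.galActionHom (toRat f) ℂ γ (ε.toEquiv p) = ε.toEquiv (w.act p)

/-! ### The counting functions -/

/-- The separable reciprocal polynomials `f ∈ ℤ[x]` of degree `2n` with coefficients in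
`[-H, H]` such that `G_g = Sₙ` and `G_f ⊆ G`. -/
def exceptionalSet {n : ℕ} (G : Subgroup (Wreath n)) (H : ℝ) : Set ℤ[X] :=
  {f | f.natDegree = 2 * n ∧ IsReciprocal f ∧ (toRat f).Separable ∧
    (∀ i, |(f.coeff i : ℝ)| ≤ H) ∧
    (∃ g : ℤ[X], IsTracePolynomial n f g ∧ HasFullSymmetricGalois g) ∧
    GaloisContainedIn f G}

theorem exceptionalSet_finite {n : ℕ} (G : Subgroup (Wreath n)) (H : ℝ) :
    (exceptionalSet G H).Finite := by
  have hinj : Set.InjOn (fun (f : ℤ[X]) (i : Fin (2 * n + 1)) => f.coeff i)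
      (exceptionalSet G H) := by
    intro f hf f' hf' h
    ext i
    by_cases hi : i < 2 * n + 1
    · exact congrFun h ⟨i, hi⟩
    · rw [coeff_eq_zero_of_natDegree_lt (by rw [hf.1]; omega),
        coeff_eq_zero_of_natDegree_lt (by rw [hf'.1]; omega)]
  refine Set.Finite.of_finite_image (Set.Finite.subset
    (Set.Finite.pi' fun _ : Fin (2 * n + 1) => Set.finite_Icc (-⌊H⌋) ⌊H⌋) ?_) hinj
  rintro _ ⟨f, hf, rfl⟩ i
  have h := abs_le.1 (hf.2.2.2.1 i)
  refine ⟨?_, Int.le_floor.2 h.2⟩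
  have : -f.coeff i ≤ ⌊H⌋ := Int.le_floor.2 (by push_cast; linarith)
  change -⌊H⌋ ≤ f.coeff i
  linarith

/-- `𝓔ₙ(G; H)`. -/
def countE {n : ℕ} (G : Subgroup (Wreath n)) (H : ℝ) : ℕ :=
  (exceptionalSet G H).ncard

/-- `𝓔ₙ^monic(G; H)`. -/
def countEMonic {n : ℕ} (G : Subgroup (Wreath n)) (H : ℝ) : ℕ :=
  {f ∈ exceptionalSet G H | f.Monic}.ncard

end

end ReciprocalGalois

/-!
If `G_f ⊆ G₃`, let `h` be the product of `x - α` over the half of the roots of `f` formed by one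
root from each pair in the labelling that realises the inclusion. Every Galois element either
fixes `h` or exchanges it with its reversal, made monic. Suitable multiples of the sum and the
difference of the two are therefore rational up to scalars, and since `f` is the product of the
two up to a scalar, `f = α A² - β B²` over `ℚ` with `A` palindromic and `B` antipalindromic.
Taking `A` and `B` primitive and reducing modulo the primes dividing the denominators yields
`4 f = a A² - b B²` with `a, b ∈ ℤ`.

If `a b > 0`, then at points of the unit circle, and if `a b < 0`, then at points of the real
axis, the two terms do not cancel, so interpolation gives `|a| Aᵢ², |b| Bᵢ² ≪ H`. As `A` and `B`
are determined by half of their coefficients, for `n = 2k + 1` a pair `(a, b)` contributes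
`≪ H^(k+1) / |a b|^((k+1)/2)` polynomials, and summing over `a` and `b` gives the general bound.

For monic `f` the leading coefficients `s, t` of `A` and `B` satisfy `a s² - b t² = 4`, so that
`(a s² - 2, s t)` solves `u² - D w² = 4` with `D = a b`. For `D > 0` the squares of the units
`(u + w √D) / 2` grow at least by the factor `D + 1` from one solution to the next, so that only
`O(log H / log (D + 1))` solutions are available for each `D`.
-/

namespace ReciprocalGalois

/-! ### Galois descent -/

section Descent

variable {K L : Type*} [Field K] [Field L] [Algebra K L]

theorem exists_map_eq_C_mul_and_sq_eq [IsGalois K L] (R : L[X]) {ω : L} (hω : ω ≠ 0)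
    (hR : ∀ γ : Gal(L/K), ∃ e : L, R.map (γ : L →+* L) = C e * R ∧ γ ω = e ^ 2 * ω) :
    ∃ (q : K) (A : K[X]) (c : L), A.map (algebraMap K L) = C c * R ∧
      R ^ 2 = C ω * (C q * A ^ 2).map (algebraMap K L) := by
  by_cases hR0 : R = 0
  · exact ⟨0, 0, 0, by simp, by simp [hR0]⟩
  have hl : R.leadingCoeff ≠ 0 := leadingCoeff_ne_zero.2 hR0
  have hcoeff (γ : Gal(L/K)) : ∃ e : L, e ≠ 0 ∧ γ ω = e ^ 2 * ω ∧
      ∀ i, γ (R.coeff i) = e * R.coeff i := by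
    obtain ⟨e, he, hγω⟩ := hR γ
    refine ⟨e, ?_, hγω, fun i => by simpa using congrArg (fun p : L[X] => p.coeff i) he⟩
    rintro rfl
    exact hω (by simpa using hγω)
  obtain ⟨q, hq⟩ : R.leadingCoeff ^ 2 / ω ∈ Set.range (algebraMap K L) := by
    refine (InfiniteGalois.mem_range_algebraMap_iff_fixed _).2 fun γ => ?_
    obtain ⟨e, he0, hγω, he⟩ := hcoeff γ
    rw [map_div₀, map_pow, hγω, leadingCoeff, he, mul_pow, mul_div_mul_left _ _ (pow_ne_zero 2 he0)]
  obtain ⟨A, hA⟩ : ∃ A : K[X], A.map (algebraMap K L) = C R.leadingCoeff⁻¹ * R := by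
    refine (mem_lifts _).1 ((lifts_iff_coeff_lifts _).2 fun i =>
      (InfiniteGalois.mem_range_algebraMap_iff_fixed _).2 fun γ => ?_)
    obtain ⟨e, he0, -, he⟩ := hcoeff γ
    rw [coeff_C_mul, map_mul, map_inv₀, leadingCoeff, he, he, mul_inv, mul_mul_mul_comm,
      inv_mul_cancel₀ he0, one_mul]
  refine ⟨q, A, _, hA, ?_⟩
  rw [Polynomial.map_mul, Polynomial.map_pow, hA, map_C, hq, mul_pow, ← C_pow, ← mul_assoc,
    ← mul_assoc, ← C_mul, ← C_mul, mul_div_cancel₀ _ hω, inv_pow,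
    mul_inv_cancel₀ (pow_ne_zero 2 hl), C_1, one_mul]

/-- The first alternative is a symmetry fixing the polynomial `h`, the second one a symmetry
exchanging `h` with its reciprocal polynomial. In both cases `h ± reflect n h` is only rescaled,
by a factor whose square is cancelled by `ω`. -/
theorem exists_map_add_C_mul_reflect_eq {n : ℕ} {h : L[X]} {ω s : L} (hω : ω ≠ 0) (hs : s ^ 2 = 1)
    {γ : Gal(L/K)} (hγs : γ s = s) (hγ : (h.map (γ : L →+* L) = h ∧ γ ω = ω) ∨
      (h.map (γ : L →+* L) = C ω⁻¹ * reflect n h ∧ γ ω = ω⁻¹)) :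
    ∃ e : L, (h + C s * reflect n h).map (γ : L →+* L) = C e * (h + C s * reflect n h) ∧
      γ ω = e ^ 2 * ω := by
  rcases hγ with ⟨hh, hγω⟩ | ⟨hh, hγω⟩
  · exact ⟨1, by simp [← reflect_map, hh, hγs], by rw [hγω, one_pow, one_mul]⟩
  · refine ⟨s * ω⁻¹, ?_, by rw [hγω, mul_pow, hs]; field_simp⟩
    have hs' : C s * C s = (1 : L[X]) := by rw [← C_mul, ← sq, hs, C_1]
    simp only [Polynomial.map_add, Polynomial.map_mul, map_C, ← reflect_map, hh, reflect_C_mul,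
      reflect_reflect, RingHom.coe_coe, hγs, C_mul]
    linear_combination -C ω⁻¹ * reflect n h * hs'

theorem exists_mul_reflect_eq [CharZero K] [IsGalois K L] {n : ℕ} {h : L[X]}
    (hdeg : h.natDegree ≤ n) {ω : L} (hω : ω ≠ 0)
    (hγ : ∀ γ : Gal(L/K), (h.map (γ : L →+* L) = h ∧ γ ω = ω) ∨
      (h.map (γ : L →+* L) = C ω⁻¹ * reflect n h ∧ γ ω = ω⁻¹)) :
    ∃ (α β : K) (A B : K[X]), A.natDegree ≤ n ∧ B.natDegree ≤ n ∧
      reflect n A = A ∧ reflect n B = -B ∧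
      h * reflect n h = C ω * (C α * A ^ 2 - C β * B ^ 2).map (algebraMap K L) := by
  have hdeg' : (reflect n h).natDegree ≤ n := natDegree_reflect_le.trans (max_le le_rfl hdeg)
  have hinj := Polynomial.map_injective _ (algebraMap K L).injective
  obtain ⟨q, A, c, hA, hq⟩ := exists_map_eq_C_mul_and_sq_eq _ hω fun γ =>
    exists_map_add_C_mul_reflect_eq hω (one_pow 2) (map_one γ) (hγ γ)
  obtain ⟨r, B, d, hB, hr⟩ := exists_map_eq_C_mul_and_sq_eq _ hω fun γ =>
    exists_map_add_C_mul_reflect_eq hω (s := -1) (by norm_num) (by simp) (hγ γ)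
  rw [C_1, one_mul] at hA hq
  rw [C_neg, C_1, neg_one_mul, ← sub_eq_add_neg] at hB hr
  refine ⟨q / 4, r / 4, A, B, ?_, ?_, hinj ?_, hinj ?_, ?_⟩
  · rw [← natDegree_map (algebraMap K L), hA]
    exact (natDegree_C_mul_le _ _).trans (natDegree_add_le_of_degree_le hdeg hdeg')
  · rw [← natDegree_map (algebraMap K L), hB]
    exact (natDegree_C_mul_le _ _).trans ((natDegree_sub_le _ _).trans (max_le hdeg hdeg'))
  · rw [← reflect_map, hA, reflect_C_mul, reflect_add, reflect_reflect, add_comm]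
  · rw [← reflect_map, Polynomial.map_neg, hB, reflect_C_mul, reflect_sub, reflect_reflect]
    ring
  · have : CharZero L := charZero_of_injective_algebraMap (algebraMap K L).injective
    have hC (t : K) : C t = (4 : K[X]) * C (t / 4) := by
      rw [← C_ofNat, ← C_mul, mul_div_cancel₀ _ (by norm_num)]
    refine mul_left_cancel₀ (by norm_num : (4 : L[X]) ≠ 0) ?_
    calc 4 * (h * reflect n h) = (h + reflect n h) ^ 2 - (h - reflect n h) ^ 2 := by ring
      _ = 4 * (C ω * (C (q / 4) * A ^ 2 - C (r / 4) * B ^ 2).map (algebraMap K L)) := by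
        rw [hq, hr, hC q, hC r]
        simp only [Polynomial.map_sub, Polynomial.map_mul, Polynomial.map_ofNat]
        ring

end Descent

section Nodal

variable {ι : Type*} {L : Type*} [Field L]

theorem reflect_nodal (s : Finset ι) {x : ι → L} (hx : ∀ i ∈ s, x i ≠ 0) :
    reflect s.card (Lagrange.nodal s x) = C (∏ i ∈ s, -x i) * Lagrange.nodal s x⁻¹ := by
  simp only [Lagrange.nodal_eq, Pi.inv_apply]
  induction s using Finset.cons_induction with
  | empty => simp
  | cons i s hi ih =>
    have hlin : reflect 1 (X - C (x i)) = C (-x i) * (X - C (x i)⁻¹) := by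
      rw [reflect_sub, reflect_one_X, reflect_C, pow_one, mul_sub, ← C_mul, neg_mul,
        mul_inv_cancel₀ (hx i (Finset.mem_cons_self i s)), C_neg, C_neg, C_1]
      ring
    rw [Finset.prod_cons, Finset.prod_cons, Finset.prod_cons, Finset.card_cons, add_comm,
      reflect_mul _ _ (natDegree_X_sub_C_le _)
        (natDegree_finsetProd_X_sub_C_eq_card s x).le,
      hlin, ih fun j hj => hx j (Finset.mem_cons_of_mem hj), C_mul]
    ring

theorem map_nodal_univ_of_perm [Fintype ι] {M : Type*} [Field M] (φ : L →+* M) {x : ι → L}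
    {y : ι → M} (σ : Equiv.Perm ι) (h : ∀ i, φ (x i) = y (σ i)) :
    (Lagrange.nodal Finset.univ x).map φ = Lagrange.nodal Finset.univ y := by
  simp only [Lagrange.nodal_eq, Polynomial.map_prod, Polynomial.map_sub, map_X, map_C, h]
  exact Equiv.prod_comp σ fun i => X - C (y i)

theorem exists_nodal_mul_nodal_inv_eq {K : Type*} [Field K] [CharZero K] [Algebra K L]
    [IsGalois K L] {n : ℕ} {x : Fin n → L} (hx : ∀ i, x i ≠ 0)
    (hγ : ∀ γ : Gal(L/K), ∃ σ : Equiv.Perm (Fin n),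
      (∀ i, γ (x i) = x (σ i)) ∨ ∀ i, γ (x i) = (x (σ i))⁻¹) :
    ∃ (α β : K) (A B : K[X]), A.natDegree ≤ n ∧ B.natDegree ≤ n ∧
      reflect n A = A ∧ reflect n B = -B ∧
      Lagrange.nodal Finset.univ x * Lagrange.nodal Finset.univ x⁻¹ =
        (C α * A ^ 2 - C β * B ^ 2).map (algebraMap K L) := by
  set ω : L := ∏ i, -x i with hω
  have hω0 : ω ≠ 0 := Finset.prod_ne_zero_iff.2 fun i _ => neg_ne_zero.2 (hx i)
  have hrefl : reflect n (Lagrange.nodal Finset.univ x) =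
      C ω * Lagrange.nodal Finset.univ x⁻¹ := by
    simpa only [Finset.card_univ, Fintype.card_fin] using
      reflect_nodal Finset.univ fun i _ => hx i
  obtain ⟨α, β, A, B, hA, hB, rA, rB, h⟩ := exists_mul_reflect_eq
    (K := K) (n := n) (h := Lagrange.nodal Finset.univ x) (by simp) hω0 fun γ => by
      obtain ⟨σ, hσ | hσ⟩ := hγ γ
      · refine Or.inl ⟨map_nodal_univ_of_perm (γ : L →+* L) σ hσ, ?_⟩
        simp only [hω, map_prod, map_neg, hσ]
        exact Equiv.prod_comp σ fun i => -x i
      · refine Or.inr ⟨?_, ?_⟩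
        · rw [hrefl, ← mul_assoc, ← C_mul, inv_mul_cancel₀ hω0, C_1, one_mul]
          exact map_nodal_univ_of_perm (γ : L →+* L) σ hσ
        · simp only [hω, map_prod, map_neg, hσ, ← Finset.prod_inv_distrib, ← inv_neg]
          exact Equiv.prod_comp σ fun i => (-x i)⁻¹
  refine ⟨α, β, A, B, hA, hB, rA, rB, mul_left_cancel₀ (C_ne_zero.2 hω0) ?_⟩
  rw [← h, hrefl]
  ring

end Nodal

theorem map_eq_C_mul_prod_of_equiv_rootSet {K E : Type*} [Field K] [Field E] [Algebra K E]
    {f : K[X]} (hsep : f.Separable) (hsplit : (f.map (algebraMap K E)).Splits) {ι : Type*}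
    [Fintype ι] (e : ι ≃ f.rootSet E) :
    f.map (algebraMap K E) =
      C (algebraMap K E f.leadingCoeff) * ∏ p, (X - C (e p : E)) := by
  classical
  conv_lhs => rw [hsplit.eq_prod_roots, leadingCoeff_map]
  congr 1
  rw [Equiv.prod_comp e fun r : f.rootSet E => X - C (r : E),
    Finset.prod_set_coe (f := fun r : E => X - C r),
    Finset.prod_eq_multiset_prod]
  simp only [rootSet_def, Finset.toFinset_coe, Multiset.toFinset_val, aroots_def,
    Multiset.dedup_eq_self.2 (nodup_roots hsep.map)]

theorem exists_equiv_rootSet_splittingField {K E : Type*} [Field K] [Field E] [Algebra K E]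
    {n : ℕ} {f : K[X]} [Fact (f.map (algebraMap K E)).Splits] {G : Subgroup (Wreath n)}
    (ε : Fin n × S2 ≃ f.rootSet E) (hε : ∀ i, (ε (i, flip) : E) = (ε (i, 1) : E)⁻¹)
    (hG : ∀ γ : f.Gal, ∃ w ∈ G, ∀ p, Gal.galActionHom f E γ (ε p) = ε (w.act p)) :
    ∃ e : Fin n × S2 ≃ f.rootSet f.SplittingField,
      (∀ i, (e (i, flip) : f.SplittingField) = (e (i, 1) : f.SplittingField)⁻¹) ∧
      ∀ γ : Gal(f.SplittingField/K), ∃ w ∈ G, ∀ p, γ (e p) = (e (w.act p) : f.SplittingField) := by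
  set e : Fin n × S2 ≃ f.rootSet f.SplittingField := ε.trans (Gal.rootsEquivRoots f E).symm
  have he (p) : algebraMap f.SplittingField E (e p) = ε p :=
    congrArg Subtype.val ((Gal.rootsEquivRoots f E).apply_symm_apply (ε p))
  refine ⟨e, fun i => ?_, fun γ => ?_⟩
  · apply (algebraMap f.SplittingField E).injective
    rw [map_inv₀, he, he, hε]
  · obtain ⟨w, hw, hact⟩ := hG γ
    refine ⟨w, hw, fun p => ?_⟩
    have hsmul : Gal.rootsEquivRoots f E ((γ : f.Gal) • e p) = ε (w.act p) := hact p
    exact congrArg Subtype.val ((Equiv.eq_symm_apply _).2 hsmul)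

theorem S2.univ_eq : (Finset.univ : Finset S2) = {1, flip} := by
  decide

theorem S2.eq_one_or_eq_flip (c : S2) : c = 1 ∨ c = flip := by
  simpa only [S2.univ_eq, Finset.mem_insert, Finset.mem_singleton] using Finset.mem_univ c

theorem exists_eq_C_mul_sq_sub_C_mul_sq_of_splittingField {K : Type*} [Field K] [CharZero K]
    {n : ℕ} {f : K[X]} (hsep : f.Separable) (e : Fin n × S2 ≃ f.rootSet f.SplittingField)
    (he : ∀ i, (e (i, flip) : f.SplittingField) = (e (i, 1) : f.SplittingField)⁻¹)
    (hG : ∀ γ : Gal(f.SplittingField/K), ∃ w ∈ G3 n, ∀ p,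
      γ (e p) = (e (w.act p) : f.SplittingField)) :
    ∃ (α β : K) (A B : K[X]), A.natDegree ≤ n ∧ B.natDegree ≤ n ∧
      reflect n A = A ∧ reflect n B = -B ∧ f = C α * A ^ 2 - C β * B ^ 2 := by
  have hne (i) : (e (i, 1) : f.SplittingField) ≠ 0 := fun h0 => by
    have h1 : e (i, flip) = e (i, 1) := Subtype.ext (by rw [he, h0, inv_zero])
    exact absurd (Prod.ext_iff.1 (e.injective h1)).2 (by decide : flip ≠ 1)
  have : IsGalois K f.SplittingField := IsGalois.of_separable_splitting_field hsep
  obtain ⟨α, β, A, B, hA, hB, rA, rB, h⟩ := exists_nodal_mul_nodal_inv_eq (K := K) hne fun γ => by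
    obtain ⟨w, ⟨c, hc⟩, hw⟩ := hG γ
    refine ⟨w.right, (S2.eq_one_or_eq_flip c).imp (fun h1 i => ?_) fun hflip i => ?_⟩
    · rw [hw, Wreath.act, hc, h1, one_mul]
    · rw [hw, Wreath.act, hc, hflip, mul_one, he]
  refine ⟨f.leadingCoeff * α, f.leadingCoeff * β, A, B, hA, hB, rA, rB,
    Polynomial.map_injective _ (algebraMap K f.SplittingField).injective ?_⟩
  have hf := map_eq_C_mul_prod_of_equiv_rootSet hsep (SplittingField.splits f) e
  rw [Fintype.prod_prod_type] at hf
  simp only [S2.univ_eq, Finset.prod_pair (by decide : (1 : S2) ≠ flip), he,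
    Finset.prod_mul_distrib] at hf
  simp only [Lagrange.nodal_eq, Pi.inv_apply] at h
  rw [hf, h, ← map_C, ← Polynomial.map_mul, C_mul, C_mul]
  congr 1
  ring

attribute [local instance] Polynomial.Gal.splits_ℚ_ℂ

theorem exists_toRat_eq_of_galoisContainedIn {n : ℕ} {f : ℤ[X]}
    (hsep : (toRat f).Separable) (hG : GaloisContainedIn f (G3 n)) :
    ∃ (α β : ℚ) (A B : ℚ[X]), A.natDegree ≤ n ∧ B.natDegree ≤ n ∧
      reflect n A = A ∧ reflect n B = -B ∧ toRat f = C α * A ^ 2 - C β * B ^ 2 := by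
  obtain ⟨ε, hε⟩ := hG
  obtain ⟨e, he, hG'⟩ := exists_equiv_rootSet_splittingField ε.toEquiv
    (fun i => by rw [← ε.flip_eq_inv, mul_one]) hε
  exact exists_eq_C_mul_sq_sub_C_mul_sq_of_splittingField hsep e he hG'

/-! ### Clearing denominators -/

theorem ne_C_mul_sq_of_separable {K : Type*} [Field K] {f : K[X]} (hf : f.Separable)
    (hdeg : f.natDegree ≠ 0) (α : K) (A : K[X]) : f ≠ C α * A ^ 2 := by
  rintro rfl
  have hA : A.natDegree = 0 :=
    natDegree_eq_zero_of_isUnit (hf.squarefree A ⟨C α, by rw [mul_comm, sq]⟩)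
  refine hdeg (Nat.le_zero.1 ((natDegree_C_mul_le _ _).trans ?_))
  rw [natDegree_pow, hA]

theorem exists_isPrimitive_eq_C_mul_map {R K : Type*} [CommRing R] [IsDomain R]
    [NormalizedGCDMonoid R] [Field K] [Algebra R K] [IsFractionRing R K] {A : K[X]} (hA : A ≠ 0) :
    ∃ (r : K) (P : R[X]), r ≠ 0 ∧ P.IsPrimitive ∧ A = C r * P.map (algebraMap R K) := by
  obtain ⟨b, hb, hbA⟩ := IsLocalization.integerNormalization_spec (nonZeroDivisors R) A
  set N := IsLocalization.integerNormalization (nonZeroDivisors R) A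
  have hN : N ≠ 0 := mt IsFractionRing.integerNormalization_eq_zero_iff.1 hA
  have hb0 : algebraMap R K b ≠ 0 := IsFractionRing.to_map_ne_zero_of_mem_nonZeroDivisors hb
  have hc0 : algebraMap R K N.content ≠ 0 := by simpa [content_eq_zero_iff] using hN
  refine ⟨algebraMap R K N.content / algebraMap R K b, N.primPart, div_ne_zero hc0 hb0,
    N.isPrimitive_primPart, mul_left_cancel₀ (C_ne_zero.2 hb0) ?_⟩
  calc C (algebraMap R K b) * A = N.map (algebraMap R K) := by
        rw [hbA, ← smul_eq_C_mul, algebraMap_smul]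
    _ = C (algebraMap R K N.content) * N.primPart.map (algebraMap R K) := by
        conv_lhs => rw [N.eq_C_content_mul_primPart]
        rw [Polynomial.map_mul, map_C]
    _ = _ := by rw [← mul_assoc, ← C_mul, mul_div_cancel₀ _ hb0]

theorem map_zmod_ne_zero_of_isPrimitive {p : ℕ} [Fact p.Prime] {A : ℤ[X]} (hA : A.IsPrimitive) :
    A.map (Int.castRingHom (ZMod p)) ≠ 0 := by
  intro h
  have hdvd : C (p : ℤ) ∣ A := (C_dvd_iff_dvd_coeff _ _).2 fun i =>
    (ZMod.intCast_zmod_eq_zero_iff_dvd _ _).1 (by simpa using congrArg (fun q => q.coeff i) h)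
  exact (Nat.prime_iff_prime_int.1 Fact.out).not_isUnit (hA _ hdvd)

theorem exists_eq_C_mul_of_C_mul_sq_eq {K : Type*} [Field K] {A B : K[X]} {u v : K} (hu : u ≠ 0)
    (h : C u * A ^ 2 = C v * B ^ 2) : ∃ t, A = C t * B := by
  rcases eq_or_ne B 0 with rfl | hB
  · refine ⟨0, ?_⟩
    simpa [hu] using h
  set a := A.leadingCoeff
  set b := B.leadingCoeff
  have hb : b ≠ 0 := leadingCoeff_ne_zero.2 hB
  have hlead : u * a ^ 2 = v * b ^ 2 := by
    simpa only [leadingCoeff_mul, leadingCoeff_C, leadingCoeff_pow] using congrArg leadingCoeff h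
  have hsq : (C b * A) ^ 2 = (C a * B) ^ 2 := by
    apply mul_left_cancel₀ (C_ne_zero.2 hu)
    calc C u * (C b * A) ^ 2 = C (b ^ 2) * (C u * A ^ 2) := by rw [C_pow]; ring
      _ = C (v * b ^ 2) * B ^ 2 := by rw [h, C_mul]; ring
      _ = C u * (C a * B) ^ 2 := by rw [← hlead, C_mul, C_pow]; ring
  obtain ⟨t, ht⟩ : ∃ t, C b * A = C t * B := by
    rcases sq_eq_sq_iff_eq_or_eq_neg.1 hsq with h1 | h1
    · exact ⟨a, h1⟩
    · exact ⟨-a, by rw [h1, C_neg, neg_mul]⟩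
  refine ⟨b⁻¹ * t, ?_⟩
  rw [C_mul, mul_assoc, ← ht, ← mul_assoc, ← C_mul, inv_mul_cancel₀ hb, C_1, one_mul]

section Reduction

variable {n : ℕ} {A B f : ℤ[X]} {u v w : ℤ}

theorem exists_map_zmod_eq_C_mul_map_zmod {p : ℕ} [Fact p.Prime] (hA : A.IsPrimitive)
    (hB : B.IsPrimitive) (h : C u * A ^ 2 - C v * B ^ 2 = C w * f) (hw : (p : ℤ) ∣ w)
    (huv : ¬ ((p : ℤ) ∣ u ∧ (p : ℤ) ∣ v)) :
    (u : ZMod p) ≠ 0 ∧ (v : ZMod p) ≠ 0 ∧ ∃ t : ZMod p,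
      A.map (Int.castRingHom (ZMod p)) = C t * B.map (Int.castRingHom (ZMod p)) := by
  have hA0 := map_zmod_ne_zero_of_isPrimitive (p := p) hA
  have hB0 := map_zmod_ne_zero_of_isPrimitive (p := p) hB
  have hmod := congrArg (Polynomial.map (Int.castRingHom (ZMod p))) h
  simp only [Polynomial.map_sub, Polynomial.map_mul, Polynomial.map_pow, map_C,
    Int.coe_castRingHom, (ZMod.intCast_zmod_eq_zero_iff_dvd w p).2 hw, C_0, zero_mul,
    sub_eq_zero] at hmod
  have huv0 : (u : ZMod p) = 0 ↔ (v : ZMod p) = 0 := by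
    refine ⟨fun h0 => ?_, fun h0 => ?_⟩
    · rw [h0, C_0, zero_mul] at hmod
      exact C_eq_zero.1 ((mul_eq_zero.1 hmod.symm).resolve_right (pow_ne_zero 2 hB0))
    · rw [h0, C_0, zero_mul] at hmod
      exact C_eq_zero.1 ((mul_eq_zero.1 hmod).resolve_right (pow_ne_zero 2 hA0))
  have hu : (u : ZMod p) ≠ 0 := fun hu => huv
    ⟨(ZMod.intCast_zmod_eq_zero_iff_dvd u p).1 hu,
      (ZMod.intCast_zmod_eq_zero_iff_dvd v p).1 (huv0.1 hu)⟩
  exact ⟨hu, mt huv0.2 hu, exists_eq_C_mul_of_C_mul_sq_eq hu hmod⟩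

theorem eq_zero_of_eq_C_mul_of_reflect {K : Type*} [Field K] (h2 : (2 : K) ≠ 0) {A B : K[X]}
    (rA : reflect n A = A) (rB : reflect n B = -B) {t : K} (h : A = C t * B) : A = 0 := by
  have hneg : A = -A := by
    conv_lhs => rw [← rA, h, reflect_C_mul, rB, mul_neg, ← h]
  have h2A : C (2 : K) * A = 0 := by
    rw [C_ofNat]
    linear_combination hneg
  exact (mul_eq_zero.1 h2A).resolve_left (C_ne_zero.2 h2)

theorem dvd_and_dvd_of_odd_prime_dvd (hA : A.IsPrimitive) (hB : B.IsPrimitive)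
    (rA : reflect n A = A) (rB : reflect n B = -B) (h : C u * A ^ 2 - C v * B ^ 2 = C w * f)
    {p : ℕ} (hp : p.Prime) (hp2 : p ≠ 2) (hw : (p : ℤ) ∣ w) : (p : ℤ) ∣ u ∧ (p : ℤ) ∣ v := by
  have : Fact p.Prime := ⟨hp⟩
  by_contra huv
  obtain ⟨-, -, t, ht⟩ := exists_map_zmod_eq_C_mul_map_zmod hA hB h hw huv
  refine map_zmod_ne_zero_of_isPrimitive (p := p) hA (eq_zero_of_eq_C_mul_of_reflect (n := n)
    ?_ (by rw [reflect_map, rA]) (by rw [reflect_map, rB, Polynomial.map_neg]) ht)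
  exact ZMod.prime_ne_zero p 2 hp2

theorem zmod_two_eq_one_of_ne_zero (c : ZMod 2) (hc : c ≠ 0) : c = 1 := by
  decide +revert

theorem sq_add_mul_add_sq_ne_zero {B D : (ZMod 2)[X]} (hB : B ≠ 0) :
    B ^ 2 + B * D + D ^ 2 ≠ 0 := by
  intro h
  have hD : D ≠ 0 := by
    rintro rfl
    simp [hB] at h
  have hdeg : B.natDegree = D.natDegree := by
    have hcube : B ^ 3 = D ^ 3 := by linear_combination (B - D) * h
    have := congrArg natDegree hcube
    simp only [natDegree_pow] at this
    omega
  have hlead (P : (ZMod 2)[X]) (hP : P ≠ 0) : P.coeff P.natDegree = 1 :=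
    zmod_two_eq_one_of_ne_zero _ (leadingCoeff_ne_zero.2 hP)
  have hcoeff := congrArg (fun q => q.coeff (D.natDegree + D.natDegree)) h
  simp only [coeff_add, coeff_zero, sq] at hcoeff
  rw [coeff_mul_add_eq_of_natDegree_le hdeg.le hdeg.le,
    coeff_mul_add_eq_of_natDegree_le hdeg.le le_rfl,
    coeff_mul_add_eq_of_natDegree_le le_rfl le_rfl, hlead D hD, ← hdeg, hlead B hB] at hcoeff
  exact absurd hcoeff (by decide)

theorem C_mul_sq_add_ne_zero_of_reflect_eq_add {B D : (ZMod 2)[X]} (hB : B ≠ 0)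
    (rD : reflect n D = B + D) (k : ZMod 2) : C k * B ^ 2 + (B * D + D ^ 2) ≠ 0 := by
  rcases (by decide +revert : k = 0 ∨ k = 1) with rfl | rfl
  · have hD : D ≠ 0 := by
      rintro rfl
      exact hB (by simpa using rD.symm)
    have hBD : B + D ≠ 0 := by rwa [← rD, Ne, reflect_eq_zero_iff]
    rw [C_0, zero_mul, zero_add, sq, ← add_mul]
    exact mul_ne_zero hBD hD
  · rw [C_1, one_mul, ← add_assoc]
    exact sq_add_mul_add_sq_ne_zero hB

theorem exists_eq_add_two_mul_of_map_zmod_two_eq (rA : reflect n A = A) (rB : reflect n B = -B)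
    (hAB : A.map (Int.castRingHom (ZMod 2)) = B.map (Int.castRingHom (ZMod 2))) :
    ∃ D, A = B + 2 * D ∧ reflect n D = B + D := by
  obtain ⟨D, hD⟩ : C (2 : ℤ) ∣ A - B := (C_dvd_iff_dvd_coeff _ _).2 fun i =>
    (ZMod.intCast_zmod_eq_zero_iff_dvd _ 2).1 (by
      simpa [sub_eq_zero] using congrArg (fun q => q.coeff i) hAB)
  refine ⟨D, by rw [← C_ofNat, ← hD]; ring, mul_left_cancel₀ (two_ne_zero (α := ℤ[X])) ?_⟩
  have hrefl := congrArg (reflect n) hD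
  rw [reflect_sub, rA, rB, reflect_C_mul, C_ofNat] at hrefl
  rw [C_ofNat] at hD
  linear_combination hD - hrefl

theorem dvd_of_C_dvd_C_mul_of_isPrimitive {R : Type*} [CommRing R] [IsDomain R]
    [NormalizedGCDMonoid R] {P : R[X]} (hP : P.IsPrimitive) {c d : R} (h : C c ∣ C d * P) :
    c ∣ d := by
  rwa [← dvd_content_iff_C_dvd, (associated_content_C_mul d P).dvd_iff_dvd_right,
    hP.content_eq_one, mul_one] at h

/-- Modulo `2` the identity only says that `A = B + 2 D`; the contradiction is found modulo `8`,
where the antipalindromic symmetry of `B` translates into `reflect n D = B + D`. -/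
theorem two_dvd_and_two_dvd_of_eight_dvd (hA : A.IsPrimitive) (hB : B.IsPrimitive)
    (rA : reflect n A = A) (rB : reflect n B = -B) (h : C u * A ^ 2 - C v * B ^ 2 = C w * f)
    (hw : 8 ∣ w) : 2 ∣ u ∧ 2 ∣ v := by
  by_contra huv
  obtain ⟨hu, -, t, ht⟩ := exists_map_zmod_eq_C_mul_map_zmod (p := 2) hA hB h
    ((by norm_num : ((2 : ℕ) : ℤ) ∣ 8).trans hw) huv
  have ht0 : t ≠ 0 := by
    rintro rfl
    exact map_zmod_ne_zero_of_isPrimitive (p := 2) hA (by rw [ht, C_0, zero_mul])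
  rw [zmod_two_eq_one_of_ne_zero t ht0, C_1, one_mul] at ht
  obtain ⟨D, rfl, rD⟩ := exists_eq_add_two_mul_of_map_zmod_two_eq rA rB ht
  obtain ⟨w', rfl⟩ := hw
  obtain ⟨k, hk⟩ : 4 ∣ u - v := by
    refine dvd_of_C_dvd_C_mul_of_isPrimitive (hB.mul hB)
      ⟨2 * C w' * f - C u * (B * D + D ^ 2), ?_⟩
    simp only [C_mul, C_sub, C_ofNat] at h ⊢
    linear_combination h
  have hk2 : C k * B ^ 2 + C u * (B * D + D ^ 2) = 2 * (C w' * f) := by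
    apply mul_left_cancel₀ (by norm_num : (4 : ℤ[X]) ≠ 0)
    obtain rfl : u = v + 4 * k := by linarith
    simp only [C_mul, C_add, C_ofNat] at h ⊢
    linear_combination h
  have hmod := congrArg (Polynomial.map (Int.castRingHom (ZMod 2))) hk2
  simp only [Polynomial.map_add, Polynomial.map_mul, Polynomial.map_pow, map_C,
    Int.coe_castRingHom, Polynomial.map_ofNat, CharTwo.two_eq_zero, zero_mul,
    zmod_two_eq_one_of_ne_zero _ hu, C_1,
    one_mul] at hmod
  refine C_mul_sq_add_ne_zero_of_reflect_eq_add (n := n)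
    (map_zmod_ne_zero_of_isPrimitive (p := 2) hB) ?_ k hmod
  rw [reflect_map, rD, Polynomial.map_add]

theorem natCast_dvd_four (hA : A.IsPrimitive) (hB : B.IsPrimitive)
    (rA : reflect n A = A) (rB : reflect n B = -B) {w : ℕ}
    (h : C u * A ^ 2 - C v * B ^ 2 = C (w : ℤ) * f)
    (hred : ∀ p : ℕ, p.Prime → p ∣ w → ¬ ((p : ℤ) ∣ u ∧ (p : ℤ) ∣ v)) : w ∣ 4 := by
  rcases w.eq_two_pow_or_exists_odd_prime_and_dvd with ⟨k, rfl⟩ | ⟨p, hp, hpw, hp2⟩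
  · refine pow_dvd_pow 2 (not_lt.1 fun hk : 2 < k => ?_)
    have h8 : 2 ^ 3 ∣ 2 ^ k := pow_dvd_pow 2 hk
    exact hred 2 Nat.prime_two ((by norm_num : 2 ∣ 2 ^ 3).trans h8)
      (two_dvd_and_two_dvd_of_eight_dvd hA hB rA rB h (by exact_mod_cast h8))
  · refine absurd (dvd_and_dvd_of_odd_prime_dvd hA hB rA rB h hp ?_ (by exact_mod_cast hpw))
      (hred p hp hpw)
    rintro rfl
    exact absurd hp2 (by decide)

end Reduction

theorem exists_common_denominator (α β : ℚ) :
    ∃ (w : ℕ) (u v : ℤ), w * α = u ∧ w * β = v ∧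
      ∀ p : ℕ, p.Prime → p ∣ w → ¬ ((p : ℤ) ∣ u ∧ (p : ℤ) ∣ v) := by
  classical
  have hex : ∃ w : ℕ, 0 < w ∧ ∃ u v : ℤ, w * α = u ∧ w * β = v := by
    refine ⟨α.den * β.den, Nat.mul_pos α.pos β.pos, α.num * β.den, β.num * α.den, ?_, ?_⟩
    · push_cast
      rw [mul_right_comm, Rat.den_mul_eq_num]
    · push_cast
      rw [mul_assoc, Rat.den_mul_eq_num, mul_comm]
  obtain ⟨hw0, u, v, hu, hv⟩ := Nat.find_spec hex
  refine ⟨Nat.find hex, u, v, hu, hv, ?_⟩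
  rintro p hp ⟨w', hw'⟩ ⟨⟨u', rfl⟩, ⟨v', rfl⟩⟩
  have hp0 : (p : ℚ) ≠ 0 := Nat.cast_ne_zero.2 hp.ne_zero
  rw [hw'] at hu hv hw0
  have hw'0 : 0 < w' := pos_of_mul_pos_right hw0 hp.pos.le
  refine Nat.find_min hex (m := w') ?_ ⟨hw'0, u', v', mul_left_cancel₀ hp0 ?_,
    mul_left_cancel₀ hp0 ?_⟩
  · rw [hw']
    exact lt_mul_of_one_lt_left hw'0 hp.one_lt
  · push_cast at hu
    linear_combination hu
  · push_cast at hv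
    linear_combination hv

theorem exists_four_mul_eq_intCast {n : ℕ} {A B f : ℤ[X]} (hA : A.IsPrimitive)
    (hB : B.IsPrimitive) (rA : reflect n A = A) (rB : reflect n B = -B) {α β : ℚ}
    (h : toRat f = C α * (toRat A) ^ 2 - C β * (toRat B) ^ 2) :
    ∃ a b : ℤ, 4 * α = a ∧ 4 * β = b := by
  obtain ⟨w, u, v, hu, hv, hred⟩ := exists_common_denominator α β
  have hform : C u * A ^ 2 - C v * B ^ 2 = C (w : ℤ) * f := by
    apply Polynomial.map_injective _ (Int.castRingHom ℚ).injective_int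
    simp only [Polynomial.map_sub, Polynomial.map_mul, Polynomial.map_pow, map_C,
      Int.coe_castRingHom, Int.cast_natCast, ← hu, ← hv, C_mul]
    linear_combination -C (w : ℚ) * h
  obtain ⟨c, hc⟩ := natCast_dvd_four hA hB rA rB hform hred
  have hc' : (4 : ℚ) = c * w := by
    rw [mul_comm]
    exact_mod_cast hc
  exact ⟨c * u, c * v, by rw [hc', mul_assoc, hu]; push_cast; rfl,
    by rw [hc', mul_assoc, hv]; push_cast; rfl⟩

/-- The decompositions `4 f = a A² - b B²` over `ℤ` with `A` palindromic and `B` antipalindromic of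
formal degree `n`. They are what remains of the condition `G_f ⊆ G₃` in the counting argument. -/
structure IsDecomposition (n : ℕ) (f : ℤ[X]) (a b : ℤ) (A B : ℤ[X]) : Prop where
  a_ne_zero : a ≠ 0
  b_ne_zero : b ≠ 0
  A_ne_zero : A ≠ 0
  B_ne_zero : B ≠ 0
  natDegree_A_le : A.natDegree ≤ n
  natDegree_B_le : B.natDegree ≤ n
  reflect_A : reflect n A = A
  reflect_B : reflect n B = -B
  eq : 4 * f = C a * A ^ 2 - C b * B ^ 2

theorem exists_isDecomposition_of_isPrimitive {n : ℕ} {f P Q : ℤ[X]} (hP : P.IsPrimitive)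
    (hQ : Q.IsPrimitive) (dP : P.natDegree ≤ n) (dQ : Q.natDegree ≤ n) (rP : reflect n P = P)
    (rQ : reflect n Q = -Q) {α β : ℚ} (hα : α ≠ 0) (hβ : β ≠ 0)
    (h : toRat f = C α * (toRat P) ^ 2 - C β * (toRat Q) ^ 2) :
    ∃ a b, IsDecomposition n f a b P Q := by
  obtain ⟨a, b, ha, hb⟩ := exists_four_mul_eq_intCast hP hQ rP rQ h
  have ha0 : (a : ℚ) ≠ 0 := ha ▸ mul_ne_zero four_ne_zero hα
  have hb0 : (b : ℚ) ≠ 0 := hb ▸ mul_ne_zero four_ne_zero hβ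
  refine ⟨a, b, Int.cast_ne_zero.1 ha0, Int.cast_ne_zero.1 hb0, hP.ne_zero, hQ.ne_zero, dP, dQ,
    rP, rQ, Polynomial.map_injective _ (Int.castRingHom ℚ).injective_int ?_⟩
  simp only [Polynomial.map_sub, Polynomial.map_mul, Polynomial.map_pow, map_C,
    Int.coe_castRingHom, ← ha, ← hb, Polynomial.map_ofNat]
  rw [C_mul (a := 4), C_mul (a := 4), C_ofNat]
  linear_combination 4 * h

theorem exists_isDecomposition {n : ℕ} {f : ℤ[X]} (hdeg : f.natDegree ≠ 0)
    (hsep : (toRat f).Separable) (hG : GaloisContainedIn f (G3 n)) :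
    ∃ a b A B, IsDecomposition n f a b A B := by
  obtain ⟨α, β, A, B, dA, dB, rA, rB, h⟩ := exists_toRat_eq_of_galoisContainedIn hsep hG
  have hinj := (Int.castRingHom ℚ).injective_int
  have hmap := Polynomial.map_injective _ hinj
  have hne := ne_C_mul_sq_of_separable hsep (by rwa [natDegree_map_eq_of_injective hinj])
  have hα : α ≠ 0 := by
    rintro rfl
    exact hne (-β) B (by rw [h, C_neg, C_0]; ring)
  have hβ : β ≠ 0 := by
    rintro rfl
    exact hne α A (by rw [h, C_0]; ring)
  have hA : A ≠ 0 := by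
    rintro rfl
    exact hne (-β) B (by rw [h, C_neg]; ring)
  have hB : B ≠ 0 := by
    rintro rfl
    exact hne α A (by rw [h]; ring)
  obtain ⟨r, P, hr, hP, rfl⟩ := exists_isPrimitive_eq_C_mul_map (R := ℤ) hA
  obtain ⟨s, Q, hs, hQ, rfl⟩ := exists_isPrimitive_eq_C_mul_map (R := ℤ) hB
  rw [reflect_C_mul, algebraMap_int_eq] at rA
  rw [reflect_C_mul, ← mul_neg, algebraMap_int_eq] at rB
  rw [natDegree_C_mul hr, algebraMap_int_eq, natDegree_map_eq_of_injective hinj] at dA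
  rw [natDegree_C_mul hs, algebraMap_int_eq, natDegree_map_eq_of_injective hinj] at dB
  have rP : reflect n P = P :=
    hmap (by rw [← reflect_map]; exact mul_left_cancel₀ (C_ne_zero.2 hr) rA)
  have rQ : reflect n Q = -Q := hmap (by
    rw [← reflect_map, Polynomial.map_neg]
    exact mul_left_cancel₀ (C_ne_zero.2 hs) rB)
  obtain ⟨a, b, hab⟩ := exists_isDecomposition_of_isPrimitive hP hQ dA dB rP rQ
    (mul_ne_zero hα (pow_ne_zero 2 hr)) (mul_ne_zero hβ (pow_ne_zero 2 hs))
    (by rw [h, algebraMap_int_eq, C_mul, C_mul, C_pow, C_pow]; ring)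
  exact ⟨a, b, P, Q, hab⟩

/-! ### The size of the two squares -/

theorem exists_norm_coeff_sq_le_mul_sum {𝕜 ι : Type*} [NormedField 𝕜] [Fintype ι] {v : ι → 𝕜}
    (hv : Function.Injective v) :
    ∃ c : ℝ, 0 ≤ c ∧ ∀ p : 𝕜[X], p.degree < Fintype.card ι → ∀ i,
      ‖p.coeff i‖ ^ 2 ≤ c * ∑ j, ‖p.eval (v j)‖ ^ 2 := by
  classical
  let L (i : ℕ) (j : ι) : ℝ := ‖(Lagrange.basis Finset.univ v j).coeff i‖
  refine ⟨∑ i ∈ Finset.range (Fintype.card ι), ∑ j, L i j ^ 2, by positivity, fun p hp i => ?_⟩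
  have hS : 0 ≤ ∑ j, ‖p.eval (v j)‖ ^ 2 := by positivity
  by_cases hi : i < Fintype.card ι
  · have hpi := Lagrange.eq_interpolate (s := Finset.univ) hv.injOn hp
    have hle : ∑ j, L i j ^ 2 ≤ ∑ i ∈ Finset.range (Fintype.card ι), ∑ j, L i j ^ 2 :=
      Finset.single_le_sum (f := fun i => ∑ j, L i j ^ 2) (fun _ _ => by positivity)
        (Finset.mem_range.2 hi)
    calc ‖p.coeff i‖ ^ 2
        = ‖∑ j, (Lagrange.basis Finset.univ v j).coeff i * p.eval (v j)‖ ^ 2 := by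
          conv_lhs => rw [hpi, Lagrange.interpolate_apply, finsetSum_coeff]
          simp only [coeff_C_mul]
          simp only [mul_comm]
      _ ≤ (∑ j, L i j * ‖p.eval (v j)‖) ^ 2 :=
          pow_le_pow_left₀ (norm_nonneg _)
            ((norm_sum_le _ _).trans_eq (Finset.sum_congr rfl fun j _ => norm_mul _ _)) 2
      _ ≤ (∑ j, L i j ^ 2) * ∑ j, ‖p.eval (v j)‖ ^ 2 := Finset.sum_mul_sq_le_sq_mul_sq _ _ _
      _ ≤ _ := mul_le_mul_of_nonneg_right hle hS
  · rw [coeff_eq_zero_of_degree_lt (hp.trans_le (by exact_mod_cast not_lt.1 hi)), norm_zero,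
      zero_pow two_ne_zero]
    positivity

theorem exists_mul_coeff_sq_le {ι : Type*} [Fintype ι] {v : ι → ℂ} (hv : Function.Injective v) :
    ∃ c : ℝ, 0 ≤ c ∧ ∀ (a M : ℝ) (A : ℤ[X]), 0 ≤ a → A.degree < Fintype.card ι →
      (∀ j, a * ‖aeval (v j) A‖ ^ 2 ≤ M) → ∀ i, a * (A.coeff i : ℝ) ^ 2 ≤ c * M := by
  obtain ⟨c, hc, h⟩ := exists_norm_coeff_sq_le_mul_sum hv
  refine ⟨c * Fintype.card ι, by positivity, fun a M A ha hA hM i => ?_⟩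
  calc a * (A.coeff i : ℝ) ^ 2 ≤ a * (c * ∑ j, ‖(A.map (algebraMap ℤ ℂ)).eval (v j)‖ ^ 2) := by
        gcongr
        simpa using h (A.map (algebraMap ℤ ℂ)) (degree_map_le.trans_lt hA) i
    _ = c * ∑ j, a * ‖aeval (v j) A‖ ^ 2 := by
        simp only [eval_map_algebraMap, ← Finset.mul_sum]
        ring
    _ ≤ c * ∑ _j : ι, M := by gcongr with j; exact hM j
    _ = c * Fintype.card ι * M := by
        rw [Finset.sum_const, Finset.card_univ, nsmul_eq_mul, mul_assoc]

theorem norm_aeval_le {f : ℤ[X]} {N : ℕ} (hf : f.natDegree ≤ N) {H : ℝ}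
    (hH : ∀ i, |(f.coeff i : ℝ)| ≤ H) {z : ℂ} (hz : ‖z‖ ≤ 1) : ‖aeval z f‖ ≤ (N + 1) * H := by
  rw [aeval_eq_sum_range' (Nat.lt_succ_of_le hf)]
  calc ‖∑ i ∈ Finset.range (N + 1), f.coeff i • z ^ i‖
      ≤ ∑ _i ∈ Finset.range (N + 1), H := by
        refine norm_sum_le_of_le _ fun i _ => ?_
        rw [zsmul_eq_mul, norm_mul, norm_pow, Complex.norm_intCast]
        exact (mul_le_of_le_one_right (abs_nonneg _) (pow_le_one₀ (norm_nonneg _) hz)).trans (hH i)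
    _ = (N + 1) * H := by
        rw [Finset.sum_const, Finset.card_range, nsmul_eq_mul, Nat.cast_succ]

theorem conj_aeval (A : ℤ[X]) (z : ℂ) :
    (starRingEnd ℂ) (aeval z A) = aeval ((starRingEnd ℂ) z) A := by
  rw [aeval_def, aeval_def, hom_eval₂]
  exact congrArg (eval₂ · _ A) (RingHom.ext_int _ _)

theorem conj_aeval_reflect_mul_pow {n : ℕ} {A : ℤ[X]} (hA : A.natDegree ≤ n) {z : ℂ}
    (hz : ‖z‖ = 1) : (starRingEnd ℂ) (aeval z (reflect n A)) * z ^ n = aeval z A := by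
  let _ : Invertible z := invertibleOfNonzero (norm_ne_zero_iff.1 (hz ▸ one_ne_zero))
  have h := eval₂_reflect_mul_pow (algebraMap ℤ ℂ) z n A hA
  rwa [invOf_eq_inv, Complex.inv_eq_conj hz, ← aeval_def, ← conj_aeval] at h

theorem abs_mul_add_abs_mul_of_mul_pos {a b x y : ℝ} (hab : 0 < a * b) (hx : 0 ≤ x) (hy : 0 ≤ y) :
    |a| * x + |b| * y = |a * x + b * y| := by
  rcases pos_and_pos_or_neg_and_neg_of_mul_pos hab with ⟨ha, hb⟩ | ⟨ha, hb⟩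
  · rw [abs_of_pos ha, abs_of_pos hb, abs_of_nonneg (by positivity)]
  · rw [abs_of_neg ha, abs_of_neg hb, abs_of_nonpos (by nlinarith)]
    ring

namespace IsDecomposition

variable {n : ℕ} {f : ℤ[X]} {a b : ℤ} {A B : ℤ[X]}

theorem four_mul_aeval {R : Type*} [CommRing R] (h : IsDecomposition n f a b A B) (x : R) :
    4 * aeval x f = a * aeval x A ^ 2 - b * aeval x B ^ 2 := by
  simpa only [map_sub, map_mul, map_pow, aeval_C, map_ofNat, algebraMap_int_eq,
    Int.coe_castRingHom] using congrArg (aeval x) h.eq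

/-- On the unit circle `A` is a real multiple and `B` an imaginary multiple of the same square
root of `z ^ n`, so that `a * A ^ 2` and `-b * B ^ 2` point in the same direction. -/
theorem norm_sq_add_eq_of_pos (h : IsDecomposition n f a b A B) (hab : 0 < a * b) {z : ℂ}
    (hz : ‖z‖ = 1) :
    |(a : ℝ)| * ‖aeval z A‖ ^ 2 + |(b : ℝ)| * ‖aeval z B‖ ^ 2 = 4 * ‖aeval z f‖ := by
  have hA := conj_aeval_reflect_mul_pow h.natDegree_A_le hz
  have hB := conj_aeval_reflect_mul_pow h.natDegree_B_le hz
  rw [h.reflect_A] at hA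
  rw [h.reflect_B, map_neg, map_neg] at hB
  have hkey : 4 * aeval z f =
      ((a * ‖aeval z A‖ ^ 2 + b * ‖aeval z B‖ ^ 2 : ℝ) : ℂ) * z ^ n := by
    push_cast
    rw [← Complex.mul_conj', ← Complex.mul_conj', h.four_mul_aeval]
    linear_combination (-(a : ℂ) * aeval z A) * hA + ((b : ℂ) * aeval z B) * hB
  rw [abs_mul_add_abs_mul_of_mul_pos (by exact_mod_cast hab) (by positivity) (by positivity)]
  simpa only [norm_mul, norm_pow, hz, one_pow, mul_one, Complex.norm_real, Real.norm_eq_abs,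
    RCLike.norm_ofNat] using (congrArg norm hkey).symm

theorem norm_sq_add_eq_of_neg (h : IsDecomposition n f a b A B) (hab : a * b < 0) (x : ℝ) :
    |(a : ℝ)| * ‖aeval (x : ℂ) A‖ ^ 2 + |(b : ℝ)| * ‖aeval (x : ℂ) B‖ ^ 2 =
      4 * ‖aeval (x : ℂ) f‖ := by
  have hreal (P : ℤ[X]) : ‖aeval (x : ℂ) P‖ = |aeval x P| := by
    rw [← Real.norm_eq_abs, ← Complex.norm_real]
    exact congrArg norm (aeval_algebraMap_apply ℂ x P)
  have hab' : 0 < (a : ℝ) * (-b : ℝ) := by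
    rw [mul_neg]
    exact_mod_cast neg_pos.2 hab
  rw [hreal, hreal, hreal, sq_abs, sq_abs, ← abs_neg (b : ℝ),
    abs_mul_add_abs_mul_of_mul_pos hab' (by positivity) (by positivity), neg_mul,
    ← sub_eq_add_neg, ← h.four_mul_aeval, abs_mul, abs_of_pos four_pos]

theorem exists_mul_coeff_sq_le_of_nodes {v : Fin (n + 1) → ℂ} (hv : Function.Injective v)
    (hv1 : ∀ j, ‖v j‖ ≤ 1) :
    ∃ c : ℝ, 0 ≤ c ∧ ∀ (H : ℝ) (f : ℤ[X]) (a b : ℤ) (A B : ℤ[X]), f.natDegree ≤ 2 * n →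
      (∀ i, |(f.coeff i : ℝ)| ≤ H) → IsDecomposition n f a b A B →
      (∀ j, |(a : ℝ)| * ‖aeval (v j) A‖ ^ 2 + |(b : ℝ)| * ‖aeval (v j) B‖ ^ 2 =
        4 * ‖aeval (v j) f‖) →
      ∀ i, |(a : ℝ)| * (A.coeff i : ℝ) ^ 2 ≤ c * H ∧ |(b : ℝ)| * (B.coeff i : ℝ) ^ 2 ≤ c * H := by
  obtain ⟨c, hc, hle⟩ := exists_mul_coeff_sq_le hv
  refine ⟨c * (4 * (2 * n + 1)), by positivity, fun H f a b A B hf hH h heq i => ?_⟩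
  have hdeg (P : ℤ[X]) (hP : P.natDegree ≤ n) : P.degree < Fintype.card (Fin (n + 1)) := by
    rw [Fintype.card_fin]
    exact (degree_le_of_natDegree_le hP).trans_lt (by exact_mod_cast n.lt_succ_self)
  have hsum (j : Fin (n + 1)) : |(a : ℝ)| * ‖aeval (v j) A‖ ^ 2 + |(b : ℝ)| *
      ‖aeval (v j) B‖ ^ 2 ≤ 4 * (2 * n + 1) * H := by
    have := norm_aeval_le hf hH (hv1 j)
    push_cast at this
    linarith [heq j]
  rw [mul_assoc c]
  exact ⟨hle _ _ A (abs_nonneg _) (hdeg A h.natDegree_A_le)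
      (fun j => (le_add_of_nonneg_right (by positivity)).trans (hsum j)) i,
    hle _ _ B (abs_nonneg _) (hdeg B h.natDegree_B_le)
      (fun j => (le_add_of_nonneg_left (by positivity)).trans (hsum j)) i⟩

theorem exists_mul_coeff_sq_le (n : ℕ) : ∃ c : ℝ, 1 ≤ c ∧ ∀ (H : ℝ) (f : ℤ[X]) (a b : ℤ)
    (A B : ℤ[X]), f.natDegree ≤ 2 * n → (∀ i, |(f.coeff i : ℝ)| ≤ H) →
      IsDecomposition n f a b A B →
      ∀ i, |(a : ℝ)| * (A.coeff i : ℝ) ^ 2 ≤ c * H ∧ |(b : ℝ)| * (B.coeff i : ℝ) ^ 2 ≤ c * H := by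
  have hζ := Complex.isPrimitiveRoot_exp (n + 1) n.succ_ne_zero
  set ζ := Complex.exp (2 * Real.pi * Complex.I / (n + 1 : ℕ))
  have hζ1 (j : ℕ) : ‖ζ ^ j‖ = 1 := by rw [norm_pow, hζ.norm'_eq_one n.succ_ne_zero, one_pow]
  obtain ⟨c₁, hc₁, hpos⟩ := exists_mul_coeff_sq_le_of_nodes (v := fun j => ζ ^ (j : ℕ))
    (fun i j hij => Fin.ext (hζ.pow_inj i.2 j.2 hij)) (fun j => (hζ1 j).le)
  obtain ⟨c₂, hc₂, hneg⟩ := exists_mul_coeff_sq_le_of_nodes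
    (v := fun j : Fin (n + 1) => (((((j : ℕ) : ℝ) + 1)⁻¹ : ℝ) : ℂ))
    (fun i j hij => Fin.ext (by simpa using hij))
    (fun j => by
      rw [Complex.norm_real, Real.norm_of_nonneg (by positivity)]
      exact inv_le_one_of_one_le₀ (le_add_of_nonneg_left (Nat.cast_nonneg _)))
  refine ⟨1 + c₁ + c₂, by linarith, fun H f a b A B hf hH h i => ?_⟩
  have hH0 : 0 ≤ H := (abs_nonneg _).trans (hH 0)
  have hle₁ : c₁ * H ≤ (1 + c₁ + c₂) * H := mul_le_mul_of_nonneg_right (by linarith) hH0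
  have hle₂ : c₂ * H ≤ (1 + c₁ + c₂) * H := mul_le_mul_of_nonneg_right (by linarith) hH0
  rcases lt_or_gt_of_ne (mul_ne_zero h.a_ne_zero h.b_ne_zero) with hab | hab
  · exact (hneg H f a b A B hf hH h (fun j => h.norm_sq_add_eq_of_neg hab _) i).imp
      (·.trans hle₂) (·.trans hle₂)
  · exact (hpos H f a b A B hf hH h (fun j => h.norm_sq_add_eq_of_pos hab (hζ1 j)) i).imp
      (·.trans hle₁) (·.trans hle₁)

end IsDecomposition

/-! ### Solutions of `u² - D w² = 4` -/

/-- The real number `(u + w √D) / 2`, a unit when `(u, w)` solves `u² - D w² = 4`. -/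
noncomputable def pellUnit (D : ℕ) (u w : ℤ) : ℝ := (u + w * √D) / 2

theorem pellUnit_mul_pellUnit_neg {D : ℕ} {u w : ℤ} (h : u ^ 2 - D * w ^ 2 = 4) :
    pellUnit D u w * pellUnit D u (-w) = 1 := by
  have hD : √(D : ℝ) * √D = D := Real.mul_self_sqrt D.cast_nonneg
  have h' : (u : ℝ) ^ 2 - D * (w : ℝ) ^ 2 = 4 := by exact_mod_cast h
  rw [pellUnit, pellUnit, Int.cast_neg]
  linear_combination (1 / 4) * h' - (w : ℝ) ^ 2 / 4 * hD

theorem inv_pellUnit {D : ℕ} {u w : ℤ} (h : u ^ 2 - D * w ^ 2 = 4) :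
    (pellUnit D u w)⁻¹ = pellUnit D u (-w) :=
  inv_eq_of_mul_eq_one_right (pellUnit_mul_pellUnit_neg h)

theorem pellUnit_sub_inv {D : ℕ} {u w : ℤ} (h : u ^ 2 - D * w ^ 2 = 4) :
    pellUnit D u w - (pellUnit D u w)⁻¹ = w * √D := by
  rw [inv_pellUnit h, pellUnit, pellUnit, Int.cast_neg]
  ring

theorem pellUnit_add_inv {D : ℕ} {u w : ℤ} (h : u ^ 2 - D * w ^ 2 = 4) :
    pellUnit D u w + (pellUnit D u w)⁻¹ = u := by
  rw [inv_pellUnit h, pellUnit, pellUnit, Int.cast_neg]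
  ring

theorem even_iff_of_pell {D : ℕ} {u w : ℤ} (h : u ^ 2 - D * w ^ 2 = 4) :
    Even u ↔ Even (D : ℤ) ∨ Even w := by
  have heven : Even (u ^ 2 - D * w ^ 2) := h ▸ by decide
  simpa [Int.even_sub, Int.even_mul, Int.even_pow] using heven

theorem exists_pellUnit_eq_mul {D : ℕ} {u w u' w' : ℤ} (h : u ^ 2 - D * w ^ 2 = 4)
    (h' : u' ^ 2 - D * w' ^ 2 = 4) : ∃ x y : ℤ, x ^ 2 - D * y ^ 2 = 4 ∧
      pellUnit D x y = pellUnit D u w * pellUnit D u' w' := by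
  have hpar := even_iff_of_pell h
  have hpar' := even_iff_of_pell h'
  obtain ⟨x, hx⟩ : Even (u * u' + D * (w * w')) := by
    simp only [Int.even_add, Int.even_mul]
    tauto
  obtain ⟨y, hy⟩ : Even (u * w' + u' * w) := by
    simp only [Int.even_add, Int.even_mul]
    tauto
  refine ⟨x, y, ?_, ?_⟩
  · refine mul_left_cancel₀ (four_ne_zero (α := ℤ)) ?_
    linear_combination (u' ^ 2 - D * w' ^ 2) * h + 4 * h' -
      (u * u' + D * (w * w') + 2 * x) * hx + D * (u * w' + u' * w + 2 * y) * hy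
  · have hD : √(D : ℝ) * √D = D := Real.mul_self_sqrt D.cast_nonneg
    have hx' : (u : ℝ) * u' + D * (w * w') = x + x := by exact_mod_cast hx
    have hy' : (u : ℝ) * w' + u' * w = y + y := by exact_mod_cast hy
    simp only [pellUnit]
    linear_combination -(1 / 4) * hx' - √D / 4 * hy' - (w : ℝ) * w' / 4 * hD

theorem add_one_le_pellUnit_sq {D : ℕ} {u w : ℤ} (h : u ^ 2 - D * w ^ 2 = 4)
    (h1 : 1 < pellUnit D u w) : (D : ℝ) + 1 ≤ pellUnit D u w ^ 2 := by
  have hsub := pellUnit_sub_inv h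
  set ε := pellUnit D u w
  have hε : 0 < ε := one_pos.trans h1
  have hD : √(D : ℝ) * √D = D := Real.mul_self_sqrt D.cast_nonneg
  have hw : 0 < w := by
    have hpos : 0 < w * √D := hsub ▸ sub_pos.2 ((inv_lt_one_of_one_lt₀ h1).trans h1)
    exact_mod_cast pos_of_mul_pos_left hpos (Real.sqrt_nonneg _)
  have hsqrt : √D ≤ ε - ε⁻¹ :=
    hsub ▸ le_mul_of_one_le_left (Real.sqrt_nonneg _) (by exact_mod_cast hw)
  have hsqrt' : √D ≤ ε := hsqrt.trans (sub_le_self _ (inv_pos.2 hε).le)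
  calc (D : ℝ) + 1 = √D * √D + 1 := by rw [hD]
    _ ≤ ε * (ε - ε⁻¹) + 1 := by gcongr
    _ = ε ^ 2 := by rw [mul_sub, mul_inv_cancel₀ hε.ne']; ring

theorem add_one_mul_pellUnit_sq_le {D : ℕ} {u w u' w' : ℤ} (h : u ^ 2 - D * w ^ 2 = 4)
    (h' : u' ^ 2 - D * w' ^ 2 = 4) (hpos : 0 < pellUnit D u w)
    (hlt : pellUnit D u w < pellUnit D u' w') :
    ((D : ℝ) + 1) * pellUnit D u w ^ 2 ≤ pellUnit D u' w' ^ 2 := by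
  obtain ⟨x, y, hxy, hε⟩ := exists_pellUnit_eq_mul h' (u' := u) (w' := -w) (by rwa [neg_sq])
  rw [← inv_pellUnit h, ← div_eq_mul_inv] at hε
  have hle := add_one_le_pellUnit_sq hxy (hε ▸ (one_lt_div hpos).2 hlt)
  rwa [hε, div_pow, le_div_iff₀ (by positivity)] at hle

theorem eq_of_pellUnit_eq {D : ℕ} (hD : 0 < D) {u w u' w' : ℤ} (h : u ^ 2 - D * w ^ 2 = 4)
    (h' : u' ^ 2 - D * w' ^ 2 = 4) (heq : pellUnit D u w = pellUnit D u' w') :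
    u = u' ∧ w = w' := by
  have hadd := pellUnit_add_inv h
  have hsub := pellUnit_sub_inv h
  rw [heq, pellUnit_add_inv h'] at hadd
  rw [heq, pellUnit_sub_inv h'] at hsub
  have hD' : √(D : ℝ) ≠ 0 := (Real.sqrt_pos.2 (by exact_mod_cast hD)).ne'
  exact ⟨by exact_mod_cast hadd.symm, by exact_mod_cast (mul_right_cancel₀ hD' hsub).symm⟩

theorem card_le_of_add_one_le_of_lt {ι : Type*} {T : Finset ι} {g : ι → ℝ} {M : ℝ} (hM : 0 ≤ M)
    (hg : ∀ p ∈ T, 1 ≤ g p ∧ g p ≤ M) (hsep : ∀ p ∈ T, ∀ q ∈ T, g p < g q → g p + 1 ≤ g q)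
    (hinj : Set.InjOn g T) : (T.card : ℝ) ≤ M := by
  have hcard : T.card ≤ (Finset.Icc 1 ⌊M⌋₊).card := by
    refine Finset.card_le_card_of_injOn (fun p => ⌊g p⌋₊) (fun p hp => ?_) fun p hp q hq hpq => ?_
    · exact Finset.mem_coe.2 (Finset.mem_Icc.2
        ⟨Nat.le_floor (by exact_mod_cast (hg p hp).1), Nat.floor_le_floor (hg p hp).2⟩)
    · have hle (p : ι) (hp : p ∈ T) (q : ι) (hq : q ∈ T) (hpq : ⌊g p⌋₊ = ⌊g q⌋₊) :
          g q ≤ g p := by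
        by_contra! hlt
        have hfloor := Nat.floor_le (zero_le_one.trans (hg p hp).1)
        rw [hpq] at hfloor
        linarith [hsep p hp q hq hlt, Nat.lt_floor_add_one (g q)]
      exact hinj hp hq ((hle q hq p hp hpq.symm).antisymm (hle p hp q hq hpq))
  rw [Nat.card_Icc, Nat.add_sub_cancel] at hcard
  exact (Nat.cast_le.2 hcard).trans (Nat.floor_le hM)

theorem one_lt_pellUnit {D : ℕ} {u w : ℤ} (hD : 0 < D) (hu : 0 < u) (hw : 0 < w)
    (h : u ^ 2 - D * w ^ 2 = 4) : 1 < pellUnit D u w := by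
  have hwD : 0 < w * √(D : ℝ) :=
    mul_pos (Int.cast_pos.2 hw) (Real.sqrt_pos.2 (Nat.cast_pos.2 hD))
  have hpos : 0 < pellUnit D u w := half_pos (add_pos (Int.cast_pos.2 hu) hwD)
  have hlt : (pellUnit D u w)⁻¹ < pellUnit D u w := by
    rwa [← sub_pos, pellUnit_sub_inv h]
  by_contra! hle
  exact (hlt.trans_le hle).not_ge ((one_le_inv₀ hpos).2 hle)

theorem card_pos_pell_le {D : ℕ} (hD : 0 < D) {U : ℝ} (hU : 1 ≤ U) (T : Finset (ℤ × ℤ))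
    (hT : ∀ u w, (u, w) ∈ T → 0 < u ∧ 0 < w ∧ u ^ 2 - D * w ^ 2 = 4 ∧ (u : ℝ) ≤ U) :
    (T.card : ℝ) ≤ 2 * (Real.log U / Real.log (D + 1)) := by
  have hD1 : 1 < (D : ℝ) + 1 := by
    have : (0 : ℝ) < D := by exact_mod_cast hD
    linarith
  have hone {u w : ℤ} (huw : (u, w) ∈ T) : 1 < pellUnit D u w :=
    let ⟨hu, hw, h, _⟩ := hT u w huw
    one_lt_pellUnit hD hu hw h
  have key := card_le_of_add_one_le_of_lt (T := T) (M := Real.logb (D + 1) (U ^ 2))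
    (g := fun p => Real.logb (D + 1) (pellUnit D p.1 p.2 ^ 2))
    (Real.logb_nonneg hD1 (one_le_pow₀ hU)) ?_ ?_ ?_
  · rwa [Real.logb, Real.log_pow, Nat.cast_two, mul_div_assoc] at key
  · rintro ⟨u, w⟩ hp
    obtain ⟨-, -, h, hle⟩ := hT u w hp
    have hpos : 0 < pellUnit D u w := one_pos.trans (hone hp)
    have hleU : pellUnit D u w ≤ U := by
      linarith [pellUnit_add_inv h, inv_pos.2 hpos]
    exact ⟨(Real.le_logb_iff_rpow_le hD1 (pow_pos hpos 2)).2
        (by rw [Real.rpow_one]; exact add_one_le_pellUnit_sq h (hone hp)),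
      Real.logb_le_logb_of_le hD1 (pow_pos hpos 2) (pow_le_pow_left₀ hpos.le hleU 2)⟩
  · rintro ⟨u, w⟩ hp ⟨u', w'⟩ hq hlt
    have hpos : 0 < pellUnit D u w := one_pos.trans (hone hp)
    have hpos' : 0 < pellUnit D u' w' := one_pos.trans (hone hq)
    have hle := add_one_mul_pellUnit_sq_le (hT u w hp).2.2.1 (hT u' w' hq).2.2.1 hpos
      (lt_of_pow_lt_pow_left₀ 2 hpos'.le
        ((Real.logb_lt_logb_iff hD1 (pow_pos hpos 2) (pow_pos hpos' 2)).1 hlt))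
    have hlog := Real.logb_le_logb_of_le hD1 (by positivity) hle
    rwa [Real.logb_mul (by positivity) (by positivity), Real.logb_self_eq_one hD1, add_comm]
      at hlog
  · rintro ⟨u, w⟩ hp ⟨u', w'⟩ hq heq
    have hpos : 0 < pellUnit D u w := one_pos.trans (hone hp)
    have hpos' : 0 < pellUnit D u' w' := one_pos.trans (hone hq)
    have hsq := Real.logb_injOn_pos hD1 (Set.mem_Ioi.2 (pow_pos hpos 2))
      (Set.mem_Ioi.2 (pow_pos hpos' 2)) heq
    exact Prod.ext_iff.2 (eq_of_pellUnit_eq hD (hT u w hp).2.2.1 (hT u' w' hq).2.2.1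
      ((pow_left_inj₀ hpos.le hpos'.le two_ne_zero).1 hsq))

theorem card_le_four_of_abs_eq {T : Finset (ℤ × ℤ)} {u w : ℤ}
    (hT : ∀ x y, (x, y) ∈ T → |x| = |u| ∧ |y| = |w|) : T.card ≤ 4 := by
  have hsub : T ⊆ ({u, -u} : Finset ℤ) ×ˢ {w, -w} := fun ⟨x, y⟩ hp => by
    simpa only [Finset.mem_product, Finset.mem_insert, Finset.mem_singleton, ← abs_eq_abs]
      using hT x y hp
  refine (Finset.card_le_card hsub).trans ?_
  rw [Finset.card_product]
  exact Nat.mul_le_mul Finset.card_le_two Finset.card_le_two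

theorem card_pell_le {D : ℕ} (hD : 0 < D) {U : ℝ} (hU : 1 ≤ U) (T : Finset (ℤ × ℤ))
    (hT : ∀ u w, (u, w) ∈ T → w ≠ 0 ∧ u ^ 2 - D * w ^ 2 = 4 ∧ |(u : ℝ)| ≤ U) :
    (T.card : ℝ) ≤ 8 * (Real.log U / Real.log (D + 1)) := by
  let φ (p : ℤ × ℤ) : ℤ × ℤ := (|p.1|, |p.2|)
  have hfibre : T.card ≤ 4 * (T.image φ).card := by
    refine Finset.card_le_mul_card_image T 4 fun p hp => ?_
    obtain ⟨q, -, rfl⟩ := Finset.mem_image.1 hp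
    refine card_le_four_of_abs_eq (u := q.1) (w := q.2) fun x y hxy => ?_
    exact Prod.ext_iff.1 (Finset.mem_filter.1 hxy).2
  have hpos := card_pos_pell_le hD hU (T.image φ) fun u w huw => by
    obtain ⟨⟨x, y⟩, hxy, heq⟩ := Finset.mem_image.1 huw
    obtain ⟨rfl, rfl⟩ := Prod.mk.inj heq
    obtain ⟨hy, h, hx⟩ := hT x y hxy
    have hDy : 0 ≤ D * y ^ 2 := by positivity
    have hx0 : x ≠ 0 := by
      rintro rfl
      linarith
    exact ⟨abs_pos.2 hx0, abs_pos.2 hy, by rwa [sq_abs, sq_abs], by rwa [Int.cast_abs]⟩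
  have hfibre' : (T.card : ℝ) ≤ 4 * (T.image φ).card := by exact_mod_cast hfibre
  linarith

/-! ### Quadruples with `a s² - b t² = 4` -/

theorem dvd_two_mul_of_mul_eq_mul {m s t s₀ t₀ : ℤ} (hs : s ^ 2 ∣ m) (ht₀ : t₀ ^ 2 ∣ m - 4)
    (h : s * t = s₀ * t₀) : s ∣ 2 * s₀ := by
  have hgcd : (Int.gcd t₀ s : ℤ) ∣ 2 := by
    have hsq : (Int.gcd t₀ s : ℤ) ^ 2 ∣ m - (m - 4) :=
      dvd_sub ((pow_dvd_pow_of_dvd (Int.gcd_dvd_right t₀ s) 2).trans hs)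
        ((pow_dvd_pow_of_dvd (Int.gcd_dvd_left t₀ s) 2).trans ht₀)
    rw [sub_sub_cancel] at hsq
    exact (Int.pow_dvd_pow_iff two_ne_zero).1 hsq
  have hdvd : s ∣ Int.gcd (s₀ * t₀) (s₀ * s) :=
    Int.dvd_coe_gcd (h ▸ dvd_mul_right s t) (dvd_mul_left s s₀)
  rw [Int.gcd_mul_left, Nat.cast_mul, Int.natCast_natAbs] at hdvd
  rw [mul_comm]
  exact hdvd.trans (mul_dvd_mul (abs_dvd_self s₀) hgcd)

theorem exists_dvd_four_two_mul_eq {a b s t a' b' s' t' : ℤ} (h : a * s ^ 2 - b * t ^ 2 = 4)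
    (h' : a' * s' ^ 2 - b' * t' ^ 2 = 4) (hs : s ≠ 0) (heq : a * s ^ 2 = a' * s' ^ 2)
    (hst : s * t = s' * t') : ∃ k : ℤ, k ∣ 4 ∧ 2 * s = s' * k := by
  obtain ⟨k, hk⟩ : s' ∣ 2 * s :=
    dvd_two_mul_of_mul_eq_mul (heq ▸ dvd_mul_left _ a') ⟨b, by linarith⟩ hst.symm
  obtain ⟨l, hl⟩ : s ∣ 2 * s' :=
    dvd_two_mul_of_mul_eq_mul (dvd_mul_left _ a) ⟨b', by linarith⟩ hst
  refine ⟨k, ⟨l, mul_left_cancel₀ hs ?_⟩, hk⟩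
  linear_combination 2 * hk + k * hl

theorem card_quadruple_fibre_le {m w : ℤ} (hw : w ≠ 0) (T : Finset (ℤ × ℤ × ℤ × ℤ))
    (hT : ∀ a b s t, (a, b, s, t) ∈ T →
      a * s ^ 2 - b * t ^ 2 = 4 ∧ a * s ^ 2 = m ∧ s * t = w) : T.card ≤ 9 := by
  rcases T.eq_empty_or_nonempty with rfl | ⟨⟨a₀, b₀, s₀, t₀⟩, hmem₀⟩
  · simp
  obtain ⟨h₀, hm₀, rfl⟩ := hT _ _ _ _ hmem₀
  have hs₀ : s₀ ≠ 0 := left_ne_zero_of_mul hw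
  have hquot (q : ℤ × ℤ × ℤ × ℤ) (hq : q ∈ T) : ∃ k : ℤ, k ∣ 4 ∧ 2 * s₀ = q.2.2.1 * k := by
    obtain ⟨h, hm, hst⟩ := hT q.1 q.2.1 q.2.2.1 q.2.2.2 hq
    exact exists_dvd_four_two_mul_eq h₀ h hs₀ (hm₀.trans hm.symm) hst.symm
  choose! k hk_dvd hk using hquot
  have hcard : T.card ≤ (Finset.Icc (-4 : ℤ) 4).card := by
    refine Finset.card_le_card_of_injOn k (fun q hq => ?_) ?_
    · exact Finset.mem_coe.2 (Finset.mem_Icc.2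
        (abs_le.1 (Int.le_of_dvd four_pos ((abs_dvd _ _).2 (hk_dvd q hq)))))
    · rintro ⟨a, b, s, t⟩ hq ⟨a', b', s', t'⟩ hq' hkk
      obtain ⟨h, hm, hst⟩ := hT _ _ _ _ hq
      obtain ⟨h', hm', hst'⟩ := hT _ _ _ _ hq'
      have hs2 : 2 * s₀ = s * k (a, b, s, t) := hk _ hq
      have hs2' : 2 * s₀ = s' * k (a, b, s, t) := hkk ▸ hk _ hq'
      have hk0 : k (a, b, s, t) ≠ 0 :=
        right_ne_zero_of_mul (hs2 ▸ mul_ne_zero two_ne_zero hs₀)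
      obtain rfl : s = s' := mul_right_cancel₀ hk0 (hs2.symm.trans hs2')
      have hs : s ≠ 0 := left_ne_zero_of_mul (hst ▸ hw)
      have ht : t ≠ 0 := right_ne_zero_of_mul (hst ▸ hw)
      obtain rfl : t = t' := mul_left_cancel₀ hs (hst.trans hst'.symm)
      obtain rfl : a = a' := mul_right_cancel₀ (pow_ne_zero 2 hs) (hm.trans hm'.symm)
      obtain rfl : b = b' := mul_right_cancel₀ (pow_ne_zero 2 ht) (by linarith)
      rfl
  simpa using hcard

theorem card_quadruple_le {D : ℕ} (hD : 0 < D) {U : ℝ} (hU : 1 ≤ U)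
    (T : Finset (ℤ × ℤ × ℤ × ℤ))
    (hT : ∀ a b s t, (a, b, s, t) ∈ T → a * s ^ 2 - b * t ^ 2 = 4 ∧ a * b = D ∧
      s * t ≠ 0 ∧ |((a * s ^ 2 - 2 : ℤ) : ℝ)| ≤ U) :
    (T.card : ℝ) ≤ 72 * (Real.log U / Real.log (D + 1)) := by
  let φ : ℤ × ℤ × ℤ × ℤ → ℤ × ℤ := fun (a, _, s, t) => (a * s ^ 2 - 2, s * t)
  have hfibre : T.card ≤ 9 * (T.image φ).card := by
    refine Finset.card_le_mul_card_image T 9 fun p hp => ?_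
    obtain ⟨⟨a₀, b₀, s₀, t₀⟩, hq, rfl⟩ := Finset.mem_image.1 hp
    refine card_quadruple_fibre_le (m := a₀ * s₀ ^ 2) (hT _ _ _ _ hq).2.2.1 _
      fun a b s t hr => ?_
    obtain ⟨hr, heq⟩ := Finset.mem_filter.1 hr
    obtain ⟨hm, hst⟩ := Prod.mk.inj heq
    exact ⟨(hT a b s t hr).1, sub_left_injective hm, hst⟩
  have hpell := card_pell_le hD hU (T.image φ) fun u w huw => by
    obtain ⟨⟨a, b, s, t⟩, hq, heq⟩ := Finset.mem_image.1 huw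
    obtain ⟨rfl, rfl⟩ := Prod.mk.inj heq
    obtain ⟨h, hab, hst, hle⟩ := hT a b s t hq
    refine ⟨hst, ?_, hle⟩
    rw [← hab]
    linear_combination a * s ^ 2 * h
  have hfibre' : (T.card : ℝ) ≤ 9 * (T.image φ).card := by exact_mod_cast hfibre
  linarith

/-! ### Counting decompositions -/

/-- The weight `d ^ (-k / 2)`. -/
noncomputable def invSqrtPow (k d : ℕ) : ℝ := (√(d : ℝ) ^ k)⁻¹

theorem invSqrtPow_nonneg (k d : ℕ) : 0 ≤ invSqrtPow k d := by
  rw [invSqrtPow]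
  positivity

theorem invSqrtPow_mul (k d e : ℕ) :
    invSqrtPow k d * invSqrtPow k e = invSqrtPow k (d * e) := by
  simp only [invSqrtPow, Nat.cast_mul, Real.sqrt_mul (Nat.cast_nonneg d), mul_pow, mul_inv]

theorem invSqrtPow_antitone_left {d : ℕ} (hd : 0 < d) : Antitone fun k => invSqrtPow k d := by
  intro k l hkl
  have hd1 : 1 ≤ √(d : ℝ) := Real.one_le_sqrt.2 (by exact_mod_cast hd)
  exact inv_anti₀ (pow_pos (one_pos.trans_le hd1) k) (pow_le_pow_right₀ hd1 hkl)

theorem invSqrtPow_le_one (k : ℕ) {d : ℕ} (hd : 0 < d) : invSqrtPow k d ≤ 1 := by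
  simpa only [invSqrtPow, pow_zero, inv_one] using invSqrtPow_antitone_left hd k.zero_le

/-- The nonzero integers of absolute value at most `K`, the range of the parameters `a` and `b`
of a decomposition. -/
noncomputable def nonzeroInts (K : ℝ) : Finset ℤ := (Finset.Icc (-⌊K⌋) ⌊K⌋).erase 0

theorem mem_Icc_floor {K : ℝ} {a : ℤ} : a ∈ Finset.Icc (-⌊K⌋) ⌊K⌋ ↔ |(a : ℝ)| ≤ K := by
  rw [Finset.mem_Icc, ← abs_le, Int.le_floor, Int.cast_abs]

theorem mem_nonzeroInts {K : ℝ} {a : ℤ} : a ∈ nonzeroInts K ↔ a ≠ 0 ∧ |(a : ℝ)| ≤ K := by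
  rw [nonzeroInts, Finset.mem_erase, mem_Icc_floor]

theorem card_Icc_floor_le {x : ℝ} (hx : 1 ≤ x) :
    ((Finset.Icc (-⌊x⌋) ⌊x⌋).card : ℝ) ≤ 3 * x := by
  have hfloor : 0 ≤ ⌊x⌋ := Int.floor_nonneg.2 (by linarith)
  have hcard : ((Finset.Icc (-⌊x⌋) ⌊x⌋).card : ℤ) = 2 * ⌊x⌋ + 1 := by
    rw [Int.card_Icc, Int.toNat_of_nonneg (by omega)]
    ring
  have hcard' : ((Finset.Icc (-⌊x⌋) ⌊x⌋).card : ℝ) = 2 * ⌊x⌋ + 1 := by exact_mod_cast hcard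
  linarith [Int.floor_le x]

/-- The integer vectors `x` of length `l` with `|a| * x i ^ 2 ≤ K` for all `i`. -/
noncomputable def coeffBox (l : ℕ) (K : ℝ) (a : ℤ) : Finset (Fin l → ℤ) :=
  Fintype.piFinset fun _ => Finset.Icc (-⌊√(K / |(a : ℝ)|)⌋) ⌊√(K / |(a : ℝ)|)⌋

theorem mem_coeffBox {l : ℕ} {K : ℝ} {a : ℤ} {x : Fin l → ℤ} (ha : a ≠ 0)
    (hx : ∀ i, |(a : ℝ)| * (x i : ℝ) ^ 2 ≤ K) : x ∈ coeffBox l K a := by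
  have ha' : 0 < |(a : ℝ)| := abs_pos.2 (Int.cast_ne_zero.2 ha)
  refine Fintype.mem_piFinset.2 fun i => mem_Icc_floor.2 (Real.abs_le_sqrt ?_)
  rw [le_div_iff₀ ha', mul_comm]
  exact hx i

theorem card_coeffBox_le (l : ℕ) {K : ℝ} {a : ℤ} (ha : a ∈ nonzeroInts K) :
    ((coeffBox l K a).card : ℝ) ≤ (3 * √K) ^ l * invSqrtPow l a.natAbs := by
  obtain ⟨ha0, haK⟩ := mem_nonzeroInts.1 ha
  have ha' : 0 < |(a : ℝ)| := abs_pos.2 (Int.cast_ne_zero.2 ha0)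
  have hone : 1 ≤ √(K / |(a : ℝ)|) := Real.one_le_sqrt.2 ((one_le_div ha').2 haK)
  rw [coeffBox, Fintype.card_piFinset_const, Nat.cast_pow, invSqrtPow, ← inv_pow, ← mul_pow,
    Nat.cast_natAbs, Int.cast_abs, mul_assoc, ← div_eq_mul_inv, ← Real.sqrt_div (ha'.le.trans haK)]
  exact pow_le_pow_left₀ (Nat.cast_nonneg _) (card_Icc_floor_le hone) l

theorem card_sigma_coeffBox_le {ι : Type*} (Q : Finset ι) (a b : ι → ℤ) {K : ℝ} (l : ℕ)
    (ha : ∀ q ∈ Q, a q ∈ nonzeroInts K) (hb : ∀ q ∈ Q, b q ∈ nonzeroInts K) :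
    ((Q.sigma fun q => coeffBox l K (a q) ×ˢ coeffBox l K (b q)).card : ℝ) ≤
      (9 * K) ^ l * ∑ q ∈ Q, invSqrtPow l (a q).natAbs * invSqrtPow l (b q).natAbs := by
  rw [Finset.card_sigma, Nat.cast_sum, Finset.mul_sum]
  refine Finset.sum_le_sum fun q hq => ?_
  have hK : 0 ≤ K := (abs_nonneg _).trans (mem_nonzeroInts.1 (ha q hq)).2
  have hsq : 9 * K = 3 * √K * (3 * √K) := by linear_combination -9 * Real.mul_self_sqrt hK
  rw [Finset.card_product, Nat.cast_mul, hsq, mul_pow, mul_mul_mul_comm]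
  exact mul_le_mul (card_coeffBox_le l (ha q hq)) (card_coeffBox_le l (hb q hq))
    (Nat.cast_nonneg _) (mul_nonneg (by positivity) (invSqrtPow_nonneg _ _))

theorem finite_and_ncard_le_of_rel {α β : Type*} {S : Set α} {T : Finset β} (r : α → β → Prop)
    (hex : ∀ x ∈ S, ∃ y ∈ T, r x y) (huniq : ∀ x x' y, r x y → r x' y → x = x') :
    S.Finite ∧ S.ncard ≤ T.card := by
  choose g hgT hg using fun x : S => hex x x.2
  have hinj : Function.Injective fun x : S => (⟨g x, hgT x⟩ : T) := fun x x' hxx' => by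
    have hg' : r x' (g x) := by
      rw [show g x = g x' from Subtype.ext_iff.1 hxx']
      exact hg x'
    exact Subtype.ext (huniq x x' (g x) (hg x) hg')
  refine ⟨Set.finite_coe_iff.1 (Finite.of_injective _ hinj), ?_⟩
  simpa only [Nat.card_coe_set_eq, Nat.card_eq_fintype_card, Fintype.card_coe]
    using Nat.card_le_card_of_injective _ hinj

theorem eq_of_reflect_eq_C_mul {R : Type*} [Semiring R] {n k : ℕ} (hn : 2 * k + 1 ≤ n) {e : R}
    (he : IsLeftRegular e) {A A' : R[X]} (hA : reflect n A = C e * A)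
    (hA' : reflect n A' = C e * A') (h : ∀ i, k < i → A.coeff i = A'.coeff i) : A = A' := by
  ext i
  rcases lt_or_ge k i with hi | hi
  · exact h i hi
  · refine he ?_
    have hrev : k < revAt n i := by
      rw [revAt_le (by omega)]
      omega
    change e * A.coeff i = e * A'.coeff i
    rw [← coeff_C_mul, ← coeff_C_mul, ← hA, ← hA', coeff_reflect, coeff_reflect, h _ hrev]

theorem abs_le_abs_mul_sq_of_ne_zero_right (a : ℤ) {s : ℤ} (hs : s ≠ 0) : |a| ≤ |a| * s ^ 2 :=
  le_mul_of_one_le_right (abs_nonneg a) (Int.add_one_le_iff.2 (sq_pos_of_ne_zero hs))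

theorem abs_le_abs_mul_sq_of_ne_zero_left {a : ℤ} (s : ℤ) (ha : a ≠ 0) : |s| ≤ |a| * s ^ 2 := by
  rw [← Int.natCast_natAbs s]
  exact (Int.natAbs_le_self_sq s).trans
    (le_mul_of_one_le_left (sq_nonneg s) (Int.one_le_abs ha))

theorem mem_nonzeroInts_of_coeff_sq_le {a : ℤ} {A : ℤ[X]} {K : ℝ} (ha : a ≠ 0) (hA : A ≠ 0)
    (h : ∀ i, |(a : ℝ)| * (A.coeff i : ℝ) ^ 2 ≤ K) : a ∈ nonzeroInts K := by
  refine mem_nonzeroInts.2 ⟨ha, le_trans ?_ (h A.natDegree)⟩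
  exact_mod_cast abs_le_abs_mul_sq_of_ne_zero_right a (leadingCoeff_ne_zero.2 hA)

/-- The polynomials admitting a decomposition `4 f = a A² - b B²` in which the coefficients of
`√|a| A` and `√|b| B` are at most `√K`. -/
def decomposableSet (n : ℕ) (K : ℝ) : Set ℤ[X] :=
  {f | ∃ a b A B, IsDecomposition n f a b A B ∧
    ∀ i, |(a : ℝ)| * (A.coeff i : ℝ) ^ 2 ≤ K ∧ |(b : ℝ)| * (B.coeff i : ℝ) ^ 2 ≤ K}

theorem IsDecomposition.eq_of_coeff_eq {n k : ℕ} (hn : 2 * k + 1 ≤ n) {f f' : ℤ[X]} {a b : ℤ}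
    {A B A' B' : ℤ[X]} (h : IsDecomposition n f a b A B) (h' : IsDecomposition n f' a b A' B')
    (hA : ∀ i, k < i → i ≤ n → A.coeff i = A'.coeff i)
    (hB : ∀ i, k < i → i ≤ n → B.coeff i = B'.coeff i) : f = f' := by
  have extend {P P' : ℤ[X]} (hP : P.natDegree ≤ n) (hP' : P'.natDegree ≤ n)
      (hPP' : ∀ i, k < i → i ≤ n → P.coeff i = P'.coeff i) (i : ℕ) (hi : k < i) :
      P.coeff i = P'.coeff i := by
    rcases le_or_gt i n with hin | hin
    · exact hPP' i hi hin
    · rw [coeff_eq_zero_of_natDegree_lt (hP.trans_lt hin),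
        coeff_eq_zero_of_natDegree_lt (hP'.trans_lt hin)]
  obtain rfl : A = A' := eq_of_reflect_eq_C_mul hn (e := 1) isRegular_one.left
    (by rw [h.reflect_A, C_1, one_mul]) (by rw [h'.reflect_A, C_1, one_mul])
    (extend h.natDegree_A_le h'.natDegree_A_le hA)
  obtain rfl : B = B' := eq_of_reflect_eq_C_mul hn (e := -1)
    (IsRegular.of_ne_zero (neg_ne_zero.2 one_ne_zero)).left
    (by rw [h.reflect_B, C_neg, C_1, neg_one_mul]) (by rw [h'.reflect_B, C_neg, C_1, neg_one_mul])
    (extend h.natDegree_B_le h'.natDegree_B_le hB)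
  exact mul_left_cancel₀ (OfNat.ofNat_ne_zero 4) (h.eq.trans h'.eq.symm)

theorem finite_and_ncard_decomposableSet_le (k : ℕ) (K : ℝ) :
    (decomposableSet (2 * k + 1) K).Finite ∧
    ((decomposableSet (2 * k + 1) K).ncard : ℝ) ≤
      (9 * K) ^ (k + 1) * (∑ a ∈ nonzeroInts K, invSqrtPow (k + 1) a.natAbs) ^ 2 := by
  let Q := nonzeroInts K ×ˢ nonzeroInts K
  let r (f : ℤ[X]) (p : Σ _ : ℤ × ℤ, (Fin (k + 1) → ℤ) × (Fin (k + 1) → ℤ)) : Prop :=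
    ∃ A B, IsDecomposition (2 * k + 1) f p.1.1 p.1.2 A B ∧
      ∀ i : Fin (k + 1), p.2.1 i = A.coeff (k + 1 + i) ∧ p.2.2 i = B.coeff (k + 1 + i)
  have hcard := card_sigma_coeffBox_le Q Prod.fst Prod.snd (k + 1)
    (fun q hq => (Finset.mem_product.1 hq).1) (fun q hq => (Finset.mem_product.1 hq).2)
  have hrel := finite_and_ncard_le_of_rel (S := decomposableSet (2 * k + 1) K)
    (T := Q.sigma fun q => coeffBox (k + 1) K q.1 ×ˢ coeffBox (k + 1) K q.2) r ?_ ?_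
  · refine ⟨hrel.1, (Nat.cast_le.2 hrel.2).trans (hcard.trans_eq ?_)⟩
    rw [sq, Finset.sum_mul_sum, ← Finset.sum_product']
  · rintro f ⟨a, b, A, B, hdec, hbound⟩
    refine ⟨⟨(a, b), fun i => A.coeff (k + 1 + i), fun i => B.coeff (k + 1 + i)⟩,
      Finset.mem_sigma.2 ⟨Finset.mem_product.2 ⟨?_, ?_⟩, Finset.mem_product.2 ⟨?_, ?_⟩⟩,
      A, B, hdec, fun i => ⟨rfl, rfl⟩⟩
    · exact mem_nonzeroInts_of_coeff_sq_le hdec.a_ne_zero hdec.A_ne_zero fun i => (hbound i).1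
    · exact mem_nonzeroInts_of_coeff_sq_le hdec.b_ne_zero hdec.B_ne_zero fun i => (hbound i).2
    · exact mem_coeffBox hdec.a_ne_zero fun i => (hbound _).1
    · exact mem_coeffBox hdec.b_ne_zero fun i => (hbound _).2
  · rintro f f' p ⟨A, B, hdec, hp⟩ ⟨A', B', hdec', hp'⟩
    refine hdec.eq_of_coeff_eq le_rfl hdec' (fun i hi hin => ?_) fun i hi hin => ?_
    all_goals obtain ⟨j, rfl⟩ := Nat.exists_eq_add_of_le hi
    · exact (hp ⟨j, by omega⟩).1.symm.trans (hp' ⟨j, by omega⟩).1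
    · exact (hp ⟨j, by omega⟩).2.symm.trans (hp' ⟨j, by omega⟩).2

/-- The quadruples `(a, b, s, t)` with `a s² - b t² = 4` in the box given by `K`; the leading
coefficients of a decomposition of a monic polynomial form such a quadruple. -/
noncomputable def quadruples (K : ℝ) : Finset (ℤ × ℤ × ℤ × ℤ) :=
  {q ∈ nonzeroInts K ×ˢ nonzeroInts K ×ˢ Finset.Icc (-⌊K⌋) ⌊K⌋ ×ˢ Finset.Icc (-⌊K⌋) ⌊K⌋ |
    q.1 * q.2.2.1 ^ 2 - q.2.1 * q.2.2.2 ^ 2 = 4 ∧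
    |(q.1 : ℝ)| * (q.2.2.1 : ℝ) ^ 2 ≤ K ∧ |(q.2.1 : ℝ)| * (q.2.2.2 : ℝ) ^ 2 ≤ K}

theorem mem_quadruples {K : ℝ} {a b s t : ℤ} : (a, b, s, t) ∈ quadruples K ↔
    a ∈ nonzeroInts K ∧ b ∈ nonzeroInts K ∧ a * s ^ 2 - b * t ^ 2 = 4 ∧
    |(a : ℝ)| * (s : ℝ) ^ 2 ≤ K ∧ |(b : ℝ)| * (t : ℝ) ^ 2 ≤ K := by
  simp only [quadruples, Finset.mem_filter, Finset.mem_product, mem_Icc_floor]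
  refine ⟨fun ⟨⟨ha, hb, _⟩, h⟩ => ⟨ha, hb, h⟩, fun ⟨ha, hb, h, hs, ht⟩ => ?_⟩
  have hs' := abs_le_abs_mul_sq_of_ne_zero_left s (mem_nonzeroInts.1 ha).1
  have ht' := abs_le_abs_mul_sq_of_ne_zero_left t (mem_nonzeroInts.1 hb).1
  exact ⟨⟨ha, hb, le_trans (by exact_mod_cast hs') hs, le_trans (by exact_mod_cast ht') ht⟩,
    h, hs, ht⟩

theorem IsDecomposition.four_mul_coeff_two_mul {n : ℕ} {f : ℤ[X]} {a b : ℤ} {A B : ℤ[X]}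
    (h : IsDecomposition n f a b A B) :
    4 * f.coeff (2 * n) = a * A.coeff n ^ 2 - b * B.coeff n ^ 2 := by
  have hcoeff := congrArg (coeff · (n + n)) h.eq
  simp only [sq, coeff_sub, coeff_C_mul, coeff_ofNat_mul,
    coeff_mul_add_eq_of_natDegree_le h.natDegree_A_le h.natDegree_A_le,
    coeff_mul_add_eq_of_natDegree_le h.natDegree_B_le h.natDegree_B_le] at hcoeff
  rwa [two_mul, sq, sq]

/-- The weight with which a quadruple of leading coefficients enters the count of monic
polynomials. -/
noncomputable def quadrupleWeight (k : ℕ) (q : ℤ × ℤ × ℤ × ℤ) : ℝ :=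
  invSqrtPow k q.1.natAbs * invSqrtPow k q.2.1.natAbs

theorem ncard_decomposableSet_coeff_eq_one_le (k : ℕ) (K : ℝ) :
    ({f ∈ decomposableSet (2 * k + 1) K | f.coeff (2 * (2 * k + 1)) = 1}.ncard : ℝ) ≤
      (9 * K) ^ k * ∑ q ∈ quadruples K, quadrupleWeight k q := by
  let r (f : ℤ[X]) (p : Σ _ : ℤ × ℤ × ℤ × ℤ, (Fin k → ℤ) × (Fin k → ℤ)) : Prop :=
    ∃ A B, IsDecomposition (2 * k + 1) f p.1.1 p.1.2.1 A B ∧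
      (p.1.2.2.1 = A.coeff (2 * k + 1) ∧ p.1.2.2.2 = B.coeff (2 * k + 1)) ∧
      ∀ i : Fin k, p.2.1 i = A.coeff (k + 1 + i) ∧ p.2.2 i = B.coeff (k + 1 + i)
  have hcard := card_sigma_coeffBox_le (quadruples K) (fun q => q.1) (fun q => q.2.1) k
    (fun _ hq => (mem_quadruples.1 hq).1) fun _ hq => (mem_quadruples.1 hq).2.1
  refine (Nat.cast_le.2 (finite_and_ncard_le_of_rel r ?_ ?_).2).trans hcard
  · rintro f ⟨⟨a, b, A, B, hdec, hbound⟩, hf⟩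
    have hlead := hdec.four_mul_coeff_two_mul
    rw [hf, mul_one] at hlead
    refine ⟨⟨(a, b, A.coeff (2 * k + 1), B.coeff (2 * k + 1)), fun i => A.coeff (k + 1 + i),
      fun i => B.coeff (k + 1 + i)⟩, Finset.mem_sigma.2 ⟨mem_quadruples.2
        ⟨?_, ?_, hlead.symm, hbound _⟩, Finset.mem_product.2 ⟨?_, ?_⟩⟩,
      A, B, hdec, ⟨rfl, rfl⟩, fun i => ⟨rfl, rfl⟩⟩
    · exact mem_nonzeroInts_of_coeff_sq_le hdec.a_ne_zero hdec.A_ne_zero fun i => (hbound i).1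
    · exact mem_nonzeroInts_of_coeff_sq_le hdec.b_ne_zero hdec.B_ne_zero fun i => (hbound i).2
    · exact mem_coeffBox hdec.a_ne_zero fun i => (hbound _).1
    · exact mem_coeffBox hdec.b_ne_zero fun i => (hbound _).2
  · rintro f f' p ⟨A, B, hdec, hp, hpi⟩ ⟨A', B', hdec', hp', hpi'⟩
    refine hdec.eq_of_coeff_eq le_rfl hdec' (fun i hi hin => ?_) fun i hi hin => ?_
    all_goals
      obtain ⟨j, rfl⟩ := Nat.exists_eq_add_of_le hi
      rcases (show j ≤ k by omega).lt_or_eq with hj | rfl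
    · exact (hpi ⟨j, hj⟩).1.symm.trans (hpi' ⟨j, hj⟩).1
    · convert hp.1.symm.trans hp'.1 using 2 <;> omega
    · exact (hpi ⟨j, hj⟩).2.symm.trans (hpi' ⟨j, hj⟩).2
    · convert hp.2.symm.trans hp'.2 using 2 <;> omega

/-- The separable polynomials of degree `2n` with coefficients in `[-H, H]` such that `G_f ⊆ G`:
the set `exceptionalSet G H` without the conditions that `f` be reciprocal and `G_g = Sₙ`. -/
def galoisContainedSet {n : ℕ} (G : Subgroup (Wreath n)) (H : ℝ) : Set ℤ[X] :=
  {f | f.natDegree = 2 * n ∧ (toRat f).Separable ∧ (∀ i, |(f.coeff i : ℝ)| ≤ H) ∧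
    GaloisContainedIn f G}

theorem exists_galoisContainedSet_subset {n : ℕ} (hn : n ≠ 0) :
    ∃ c : ℝ, 1 ≤ c ∧ ∀ H : ℝ, galoisContainedSet (G3 n) H ⊆ decomposableSet n (c * H) := by
  obtain ⟨c, hc1, hc⟩ := IsDecomposition.exists_mul_coeff_sq_le n
  refine ⟨c, hc1, fun H f ⟨hdeg, hsep, hbound, hG⟩ => ?_⟩
  obtain ⟨a, b, A, B, hdec⟩ := exists_isDecomposition (by omega) hsep hG
  exact ⟨a, b, A, B, hdec, hc H f a b A B hdeg.le hbound hdec⟩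

theorem finite_galoisContainedSet (k : ℕ) (H : ℝ) :
    (galoisContainedSet (G3 (2 * k + 1)) H).Finite := by
  obtain ⟨c, -, hc⟩ := exists_galoisContainedSet_subset (n := 2 * k + 1) (by omega)
  exact (finite_and_ncard_decomposableSet_le k (c * H)).1.subset (hc H)

theorem exists_ncard_galoisContainedSet_le (k : ℕ) : ∃ c : ℝ, 1 ≤ c ∧ ∀ H : ℝ,
    ((galoisContainedSet (G3 (2 * k + 1)) H).ncard : ℝ) ≤ (9 * (c * H)) ^ (k + 1) *
      (∑ a ∈ nonzeroInts (c * H), invSqrtPow (k + 1) a.natAbs) ^ 2 := by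
  obtain ⟨c, hc1, hc⟩ := exists_galoisContainedSet_subset (n := 2 * k + 1) (by omega)
  refine ⟨c, hc1, fun H => ?_⟩
  obtain ⟨hfin, hle⟩ := finite_and_ncard_decomposableSet_le k (c * H)
  exact (Nat.cast_le.2 (Set.ncard_le_ncard (hc H) hfin)).trans hle

theorem exists_ncard_monic_galoisContainedSet_le (k : ℕ) : ∃ c : ℝ, 1 ≤ c ∧ ∀ H : ℝ,
    ({f ∈ galoisContainedSet (G3 (2 * k + 1)) H | f.Monic}.ncard : ℝ) ≤ (9 * (c * H)) ^ k *
      ∑ q ∈ quadruples (c * H), quadrupleWeight k q := by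
  obtain ⟨c, hc1, hc⟩ := exists_galoisContainedSet_subset (n := 2 * k + 1) (by omega)
  refine ⟨c, hc1, fun H => ?_⟩
  have hfin := (finite_and_ncard_decomposableSet_le k (c * H)).1
  refine (Nat.cast_le.2 (Set.ncard_le_ncard (fun f hf => ?_)
    (hfin.subset (Set.sep_subset _ _)))).trans (ncard_decomposableSet_coeff_eq_one_le k (c * H))
  exact ⟨hc H hf.1, hf.1.1 ▸ hf.2⟩

/-! ### The sum over quadruples -/

theorem sum_nonzeroInts_le {K : ℝ} (hK : 0 ≤ K) {g : ℕ → ℝ} (hg : ∀ d, 0 ≤ g d) :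
    ∑ a ∈ nonzeroInts K, g a.natAbs ≤ 2 * ∑ d ∈ Finset.Icc 1 ⌊K⌋₊, g d := by
  have hmaps : ∀ a ∈ nonzeroInts K, a.natAbs ∈ Finset.Icc 1 ⌊K⌋₊ := by
    intro a ha
    obtain ⟨ha0, haK⟩ := mem_nonzeroInts.1 ha
    refine Finset.mem_Icc.2 ⟨Int.natAbs_pos.2 ha0, (Nat.le_floor_iff hK).2 ?_⟩
    rwa [Nat.cast_natAbs, Int.cast_abs]
  rw [← Finset.sum_fiberwise_of_maps_to' hmaps, Finset.mul_sum]
  refine Finset.sum_le_sum fun d _ => ?_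
  have hsub : {a ∈ nonzeroInts K | a.natAbs = d} ⊆ {(d : ℤ), -(d : ℤ)} := fun a ha => by
    simpa only [Finset.mem_insert, Finset.mem_singleton] using
      Int.natAbs_eq_iff.1 (Finset.mem_filter.1 ha).2
  rw [Finset.sum_const, nsmul_eq_mul]
  exact mul_le_mul_of_nonneg_right
    (by exact_mod_cast (Finset.card_le_card hsub).trans Finset.card_le_two) (hg d)

theorem mem_Icc_neg_four_four_of_abs_mul_sq_le {a s : ℤ} (ha : a ≠ 0) (hs : s ≠ 0)
    (h : |a| * s ^ 2 ≤ 4) : a ∈ Finset.Icc (-4) 4 ∧ s ∈ Finset.Icc (-4) 4 := by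
  rw [Finset.mem_Icc, Finset.mem_Icc, ← abs_le, ← abs_le]
  exact ⟨(abs_le_abs_mul_sq_of_ne_zero_right a hs).trans h,
    (abs_le_abs_mul_sq_of_ne_zero_left s ha).trans h⟩

theorem abs_mul_sq_add_abs_mul_sq_eq_four {a b s t : ℤ} (h : a * s ^ 2 - b * t ^ 2 = 4)
    (hab : a * b < 0) : |a| * s ^ 2 + |b| * t ^ 2 = 4 := by
  rcases mul_neg_iff.1 hab with ⟨ha, hb⟩ | ⟨ha, hb⟩
  · rw [abs_of_pos ha, abs_of_neg hb, neg_mul, ← sub_eq_add_neg, h]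
  · have hs : a * s ^ 2 ≤ 0 := mul_nonpos_of_nonpos_of_nonneg ha.le (sq_nonneg s)
    have ht : 0 ≤ b * t ^ 2 := mul_nonneg hb.le (sq_nonneg t)
    linarith

theorem natAbs_pos_of_mem_quadruples {K : ℝ} {q : ℤ × ℤ × ℤ × ℤ} (hq : q ∈ quadruples K) :
    0 < q.1.natAbs ∧ 0 < q.2.1.natAbs := by
  obtain ⟨ha, hb, -⟩ := mem_quadruples.1 hq
  exact ⟨Int.natAbs_pos.2 (mem_nonzeroInts.1 ha).1, Int.natAbs_pos.2 (mem_nonzeroInts.1 hb).1⟩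

section

variable (k : ℕ)

theorem quadrupleWeight_nonneg (q : ℤ × ℤ × ℤ × ℤ) : 0 ≤ quadrupleWeight k q :=
  mul_nonneg (invSqrtPow_nonneg _ _) (invSqrtPow_nonneg _ _)

theorem sum_quadruples_left_eq_zero_le (K : ℝ) :
    ∑ q ∈ quadruples K with q.2.2.1 = 0, quadrupleWeight k q ≤
      81 * ∑ a ∈ nonzeroInts K, invSqrtPow k a.natAbs := by
  have hsub : {q ∈ quadruples K | q.2.2.1 = 0} ⊆
      nonzeroInts K ×ˢ Finset.Icc (-4) 4 ×ˢ {0} ×ˢ Finset.Icc (-4) 4 := by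
    rintro ⟨a, b, s, t⟩ hq
    obtain ⟨hq, rfl : s = 0⟩ := Finset.mem_filter.1 hq
    obtain ⟨ha, hb, h, -⟩ := mem_quadruples.1 hq
    have hbt : b * t ^ 2 = -4 := by linarith
    have ht : t ≠ 0 := by
      rintro rfl
      norm_num at hbt
    have habs : |b| * t ^ 2 ≤ 4 := by rw [← abs_sq t, ← abs_mul, hbt]; rfl
    obtain ⟨hb', ht'⟩ :=
      mem_Icc_neg_four_four_of_abs_mul_sq_le (mem_nonzeroInts.1 hb).1 ht habs
    simp only [Finset.mem_product, Finset.mem_singleton]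
    exact ⟨ha, hb', trivial, ht'⟩
  calc ∑ q ∈ quadruples K with q.2.2.1 = 0, quadrupleWeight k q
      ≤ ∑ q ∈ quadruples K with q.2.2.1 = 0, invSqrtPow k q.1.natAbs :=
        Finset.sum_le_sum fun q hq => mul_le_of_le_one_right (invSqrtPow_nonneg _ _)
          (invSqrtPow_le_one k (natAbs_pos_of_mem_quadruples (Finset.mem_filter.1 hq).1).2)
    _ ≤ _ := Finset.sum_le_sum_of_subset_of_nonneg hsub fun _ _ _ => invSqrtPow_nonneg _ _
    _ = 81 * ∑ a ∈ nonzeroInts K, invSqrtPow k a.natAbs := by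
        rw [Finset.sum_product, Finset.mul_sum]
        refine Finset.sum_congr rfl fun a _ => ?_
        refine (Finset.sum_const (invSqrtPow k a.natAbs)).trans ?_
        rw [nsmul_eq_mul, Finset.card_product, Finset.card_product, Finset.card_singleton,
          Int.card_Icc]
        exact congrArg (· * _) (by norm_cast)

theorem sum_quadruples_right_eq_zero_le (K : ℝ) :
    ∑ q ∈ quadruples K with q.2.2.2 = 0, quadrupleWeight k q ≤
      81 * ∑ a ∈ nonzeroInts K, invSqrtPow k a.natAbs := by
  let swap : ℤ × ℤ × ℤ × ℤ → ℤ × ℤ × ℤ × ℤ := fun (a, b, s, t) => (-b, -a, t, s)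
  have hswap {q : ℤ × ℤ × ℤ × ℤ} (hq : q ∈ quadruples K) : swap q ∈ quadruples K := by
    obtain ⟨ha, hb, h, hs, ht⟩ := mem_quadruples.1 hq
    simp only [swap, mem_quadruples, mem_nonzeroInts, neg_ne_zero, Int.cast_neg, abs_neg]
    exact ⟨mem_nonzeroInts.1 hb, mem_nonzeroInts.1 ha, by linear_combination h, ht, hs⟩
  have hinv (q : ℤ × ℤ × ℤ × ℤ) : swap (swap q) = q := by simp only [swap, neg_neg]
  refine (Finset.sum_nbij' swap swap (fun q hq => ?_) (fun q hq => ?_) (fun q _ => hinv q)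
    (fun q _ => hinv q) fun q _ => ?_).trans_le (sum_quadruples_left_eq_zero_le k K)
  · exact Finset.mem_filter.2 ⟨hswap (Finset.mem_filter.1 hq).1, (Finset.mem_filter.1 hq).2⟩
  · exact Finset.mem_filter.2 ⟨hswap (Finset.mem_filter.1 hq).1, (Finset.mem_filter.1 hq).2⟩
  · simp only [swap, quadrupleWeight, Int.natAbs_neg, mul_comm]

theorem sum_quadruples_mul_neg_le (K : ℝ) :
    ∑ q ∈ quadruples K with q.2.2.1 * q.2.2.2 ≠ 0 ∧ q.1 * q.2.1 < 0, quadrupleWeight k q ≤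
      6561 := by
  have hsub : {q ∈ quadruples K | q.2.2.1 * q.2.2.2 ≠ 0 ∧ q.1 * q.2.1 < 0} ⊆
      Finset.Icc (-4) 4 ×ˢ Finset.Icc (-4) 4 ×ˢ Finset.Icc (-4) 4 ×ˢ Finset.Icc (-4) 4 := by
    rintro ⟨a, b, s, t⟩ hq
    obtain ⟨hq, hst, hab⟩ := Finset.mem_filter.1 hq
    obtain ⟨ha, hb, h, -⟩ := mem_quadruples.1 hq
    have hsum := abs_mul_sq_add_abs_mul_sq_eq_four h hab
    have hs : 0 ≤ |a| * s ^ 2 := by positivity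
    have ht : 0 ≤ |b| * t ^ 2 := by positivity
    obtain ⟨ha', hs'⟩ := mem_Icc_neg_four_four_of_abs_mul_sq_le (mem_nonzeroInts.1 ha).1
      (left_ne_zero_of_mul hst) (by linarith)
    obtain ⟨hb', ht'⟩ := mem_Icc_neg_four_four_of_abs_mul_sq_le (mem_nonzeroInts.1 hb).1
      (right_ne_zero_of_mul hst) (by linarith)
    simp only [Finset.mem_product]
    exact ⟨ha', hb', hs', ht'⟩
  have hcard := Finset.card_le_card hsub
  rw [Finset.card_product, Finset.card_product, Finset.card_product, Int.card_Icc] at hcard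
  refine (Finset.sum_le_card_nsmul _ _ 1 fun q hq => ?_).trans ?_
  · obtain ⟨ha, hb⟩ := natAbs_pos_of_mem_quadruples (Finset.mem_filter.1 hq).1
    exact mul_le_one₀ (invSqrtPow_le_one k ha) (invSqrtPow_nonneg _ _) (invSqrtPow_le_one k hb)
  · rw [nsmul_eq_mul, mul_one]
    exact_mod_cast hcard

theorem card_quadruples_mul_eq_le {K : ℝ} (hK : 1 ≤ K) {D : ℕ} (hD : 0 < D) :
    ({q ∈ quadruples K | q.2.2.1 * q.2.2.2 ≠ 0 ∧ q.1 * q.2.1 = (D : ℤ)}.card : ℝ) ≤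
      72 * (Real.log (3 * K) / Real.log (D + 1)) := by
  refine card_quadruple_le hD (by linarith) _ fun a b s t hq => ?_
  obtain ⟨hq, hst, hab⟩ := Finset.mem_filter.1 hq
  obtain ⟨-, -, h, hs, -⟩ := mem_quadruples.1 hq
  refine ⟨h, hab, hst, ?_⟩
  calc |((a * s ^ 2 - 2 : ℤ) : ℝ)| ≤ |(a : ℝ)| * (s : ℝ) ^ 2 + 2 := by
        push_cast
        refine (abs_sub _ _).trans_eq ?_
        rw [abs_mul, abs_sq, abs_two]
    _ ≤ 3 * K := by linarith

theorem sum_quadruples_mul_pos_le {K : ℝ} (hK : 1 ≤ K) :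
    ∑ q ∈ quadruples K with q.2.2.1 * q.2.2.2 ≠ 0 ∧ 0 < q.1 * q.2.1, quadrupleWeight k q ≤
      72 * Real.log (3 * K) *
        ∑ D ∈ Finset.Icc 1 ⌊K ^ 2⌋₊, invSqrtPow k D / Real.log (D + 1) := by
  have hmaps : ∀ q ∈ {q ∈ quadruples K | q.2.2.1 * q.2.2.2 ≠ 0 ∧ 0 < q.1 * q.2.1},
      (q.1 * q.2.1).natAbs ∈ Finset.Icc 1 ⌊K ^ 2⌋₊ := by
    intro q hq
    obtain ⟨hq, -, hab⟩ := Finset.mem_filter.1 hq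
    obtain ⟨ha, hb, -⟩ := mem_quadruples.1 hq
    refine Finset.mem_Icc.2 ⟨Int.natAbs_pos.2 hab.ne', (Nat.le_floor_iff (by positivity)).2 ?_⟩
    rw [Nat.cast_natAbs, Int.cast_abs, Int.cast_mul, abs_mul, sq]
    exact mul_le_mul (mem_nonzeroInts.1 ha).2 (mem_nonzeroInts.1 hb).2 (abs_nonneg _)
      (by linarith)
  rw [← Finset.sum_fiberwise_of_maps_to hmaps, Finset.mul_sum]
  refine Finset.sum_le_sum fun D hD => ?_
  rw [Finset.filter_filter]
  have hweight : ∀ q ∈ {q ∈ quadruples K | (q.2.2.1 * q.2.2.2 ≠ 0 ∧ 0 < q.1 * q.2.1) ∧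
      (q.1 * q.2.1).natAbs = D}, quadrupleWeight k q = invSqrtPow k D := fun q hq => by
    rw [quadrupleWeight, invSqrtPow_mul, ← Int.natAbs_mul, (Finset.mem_filter.1 hq).2.2]
  have hcard : ({q ∈ quadruples K | (q.2.2.1 * q.2.2.2 ≠ 0 ∧ 0 < q.1 * q.2.1) ∧
      (q.1 * q.2.1).natAbs = D}.card : ℝ) ≤ 72 * (Real.log (3 * K) / Real.log (D + 1)) := by
    refine le_trans (Nat.cast_le.2 (Finset.card_le_card ?_))
      (card_quadruples_mul_eq_le hK (Finset.mem_Icc.1 hD).1)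
    refine Finset.monotone_filter_right _ fun q _ hq => ⟨hq.1.1, ?_⟩
    rw [← hq.2, Int.natAbs_of_nonneg hq.1.2.le]
  calc _ = _ * invSqrtPow k D := by
        rw [Finset.sum_congr rfl hweight, Finset.sum_const, nsmul_eq_mul]
    _ ≤ 72 * (Real.log (3 * K) / Real.log (D + 1)) * invSqrtPow k D :=
        mul_le_mul_of_nonneg_right hcard (invSqrtPow_nonneg k D)
    _ = 72 * Real.log (3 * K) * (invSqrtPow k D / Real.log (D + 1)) := by ring

theorem sum_quadruples_le {K : ℝ} (hK : 1 ≤ K) :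
    ∑ q ∈ quadruples K, quadrupleWeight k q ≤
      6561 + 324 * ∑ d ∈ Finset.Icc 1 ⌊K⌋₊, invSqrtPow k d + 72 * Real.log (3 * K) *
        ∑ D ∈ Finset.Icc 1 ⌊K ^ 2⌋₊, invSqrtPow k D / Real.log (D + 1) := by
  have hsplit : ∑ q ∈ quadruples K, quadrupleWeight k q ≤
      ∑ q ∈ quadruples K with q.2.2.1 = 0, quadrupleWeight k q +
      ∑ q ∈ quadruples K with q.2.2.2 = 0, quadrupleWeight k q +
      ∑ q ∈ quadruples K with q.2.2.1 * q.2.2.2 ≠ 0 ∧ q.1 * q.2.1 < 0, quadrupleWeight k q +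
      ∑ q ∈ quadruples K with q.2.2.1 * q.2.2.2 ≠ 0 ∧ 0 < q.1 * q.2.1,
        quadrupleWeight k q := by
    simp only [Finset.sum_filter, ← Finset.sum_add_distrib]
    refine Finset.sum_le_sum fun q hq => ?_
    have hweight := quadrupleWeight_nonneg k q
    have hab : q.1 * q.2.1 ≠ 0 := Int.natAbs_ne_zero.1 (by
      rw [Int.natAbs_mul]
      exact (Nat.mul_pos (natAbs_pos_of_mem_quadruples hq).1
        (natAbs_pos_of_mem_quadruples hq).2).ne')
    rcases hab.lt_or_gt with hlt | hgt <;> split_ifs <;> simp_all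
  have hleft := sum_quadruples_left_eq_zero_le k K
  have hright := sum_quadruples_right_eq_zero_le k K
  have hneg := sum_quadruples_mul_neg_le k K
  have hpos := sum_quadruples_mul_pos_le k hK
  have hints := sum_nonzeroInts_le (zero_le_one.trans hK) (invSqrtPow_nonneg k)
  linarith

end

/-! ### Elementary sums -/

theorem sum_invSqrtPow_two_le {K : ℝ} (hK : 1 ≤ K) :
    ∑ d ∈ Finset.Icc 1 ⌊K⌋₊, invSqrtPow 2 d ≤ 1 + Real.log K := by
  have h := harmonic_floor_le_one_add_log K hK
  rw [harmonic_eq_sum_Icc] at h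
  push_cast at h
  simpa only [invSqrtPow, Real.sq_sqrt (Nat.cast_nonneg _)] using h

theorem sum_invSqrtPow_one_le (N : ℕ) :
    ∑ d ∈ Finset.Icc 1 N, invSqrtPow 1 d ≤ 2 * √(N : ℝ) := by
  induction N with
  | zero => simp
  | succ N ih =>
    have hpos : 0 < √((N : ℝ) + 1) := Real.sqrt_pos.2 (by positivity)
    have hsq := Real.sq_sqrt (Nat.cast_nonneg (α := ℝ) N)
    have hsq' := Real.sq_sqrt (show 0 ≤ (N : ℝ) + 1 by positivity)
    have hstep : invSqrtPow 1 (N + 1) ≤ 2 * √((N : ℝ) + 1) - 2 * √(N : ℝ) := by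
      rw [invSqrtPow, pow_one, Nat.cast_add_one, inv_eq_one_div, div_le_iff₀ hpos]
      nlinarith [sq_nonneg (√((N : ℝ) + 1) - √(N : ℝ))]
    rw [Finset.sum_Icc_succ_top (by omega), Nat.cast_add_one]
    linarith

theorem summable_invSqrtPow_three : Summable (invSqrtPow 3) := by
  refine (Real.summable_nat_rpow_inv.2 (show (1 : ℝ) < 3 / 2 by norm_num)).congr fun d => ?_
  rw [invSqrtPow, Real.sqrt_eq_rpow, ← Real.rpow_natCast, ← Real.rpow_mul (Nat.cast_nonneg _)]
  norm_num

theorem exists_sum_invSqrtPow_le : ∃ c : ℝ, 0 ≤ c ∧ ∀ k : ℕ, 3 ≤ k → ∀ N : ℕ,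
    ∑ d ∈ Finset.Icc 1 N, invSqrtPow k d ≤ c := by
  refine ⟨∑' d, invSqrtPow 3 d, tsum_nonneg (invSqrtPow_nonneg 3), fun k hk N => ?_⟩
  exact (Finset.sum_le_sum fun d hd => invSqrtPow_antitone_left (Finset.mem_Icc.1 hd).1 hk).trans
    (summable_invSqrtPow_three.sum_le_tsum _ fun d _ => invSqrtPow_nonneg 3 d)

theorem half_le_log_add_one {D : ℕ} (hD : 1 ≤ D) : 1 / 2 ≤ Real.log ((D : ℝ) + 1) := by
  have hD' : (1 : ℝ) ≤ D := by exact_mod_cast hD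
  linarith [Real.log_two_gt_d9, Real.log_le_log two_pos (show 2 ≤ (D : ℝ) + 1 by linarith)]

section

variable (k : ℕ)

theorem invSqrtPow_div_log_nonneg (D : ℕ) : 0 ≤ invSqrtPow k D / Real.log (D + 1) :=
  div_nonneg (invSqrtPow_nonneg k D) (Real.log_nonneg (by linarith [D.cast_nonneg (α := ℝ)]))

theorem invSqrtPow_div_log_le {D : ℕ} (hD : 1 ≤ D) :
    invSqrtPow k D / Real.log (D + 1) ≤ 2 * invSqrtPow k D := by
  have hlog := half_le_log_add_one hD
  rw [div_le_iff₀ (by linarith)]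
  nlinarith [invSqrtPow_nonneg k D]

theorem sum_invSqrtPow_div_log_le (N : ℕ) :
    ∑ D ∈ Finset.Icc 1 N, invSqrtPow k D / Real.log (D + 1) ≤
      2 * ∑ D ∈ Finset.Icc 1 N, invSqrtPow k D := by
  rw [Finset.mul_sum]
  exact Finset.sum_le_sum fun D hD => invSqrtPow_div_log_le k (Finset.mem_Icc.1 hD).1

theorem sum_invSqrtPow_div_log_le_add {M : ℕ} (hM : 1 ≤ M) (N : ℕ) :
    ∑ D ∈ Finset.Icc 1 N, invSqrtPow k D / Real.log (D + 1) ≤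
      2 * ∑ D ∈ Finset.Icc 1 M, invSqrtPow k D +
        (∑ D ∈ Finset.Icc 1 N, invSqrtPow k D) / Real.log (M + 1) := by
  have hlog : 0 < Real.log ((M : ℝ) + 1) := by linarith [half_le_log_add_one hM]
  have hsub : {D ∈ Finset.Icc 1 N | D ≤ M} ⊆ Finset.Icc 1 M := fun D hD => by
    obtain ⟨hD, hDM⟩ := Finset.mem_filter.1 hD
    exact Finset.mem_Icc.2 ⟨(Finset.mem_Icc.1 hD).1, hDM⟩
  rw [← Finset.sum_filter_add_sum_filter_not _ (· ≤ M)]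
  refine add_le_add ?_ ?_
  · exact (Finset.sum_le_sum_of_subset_of_nonneg hsub fun D _ _ =>
      invSqrtPow_div_log_nonneg k D).trans (sum_invSqrtPow_div_log_le k M)
  · rw [Finset.sum_div]
    refine (Finset.sum_le_sum fun D hD => ?_).trans
      (Finset.sum_le_sum_of_subset_of_nonneg (Finset.filter_subset _ _) fun D _ _ =>
        div_nonneg (invSqrtPow_nonneg k D) hlog.le)
    have hMD : (M : ℝ) ≤ D := by exact_mod_cast (not_le.1 (Finset.mem_filter.1 hD).2).le
    exact div_le_div_of_nonneg_left (invSqrtPow_nonneg k D) hlog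
      (Real.log_le_log (by positivity) (by linarith))

end

theorem log_mul_sum_invSqrtPow_one_div_log_le {K : ℝ} (hK : 1 < K) :
    Real.log K * ∑ D ∈ Finset.Icc 1 ⌊K ^ 2⌋₊, invSqrtPow 1 D / Real.log (D + 1) ≤ 10 * K := by
  have hK0 : 0 ≤ K := by linarith
  have hlog : 0 < Real.log K := Real.log_pos hK
  have hlog_le : Real.log K ≤ 2 * √K := by
    have h := Real.log_le_sub_one_of_pos (Real.sqrt_pos.2 (zero_lt_one.trans hK))
    rw [Real.log_sqrt hK0] at h
    linarith
  have hsmall : ∑ D ∈ Finset.Icc 1 ⌊K⌋₊, invSqrtPow 1 D ≤ 2 * √K :=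
    (sum_invSqrtPow_one_le _).trans
      (mul_le_mul_of_nonneg_left (Real.sqrt_le_sqrt (Nat.floor_le hK0)) two_pos.le)
  have hall : ∑ D ∈ Finset.Icc 1 ⌊K ^ 2⌋₊, invSqrtPow 1 D ≤ 2 * K := by
    refine (sum_invSqrtPow_one_le _).trans (mul_le_mul_of_nonneg_left ?_ two_pos.le)
    exact (Real.sqrt_le_sqrt (Nat.floor_le (sq_nonneg K))).trans_eq (Real.sqrt_sq hK0)
  have hquot : (∑ D ∈ Finset.Icc 1 ⌊K ^ 2⌋₊, invSqrtPow 1 D) / Real.log (⌊K⌋₊ + 1) ≤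
      2 * K / Real.log K :=
    div_le_div₀ (by linarith) hall hlog
      (Real.log_le_log (by linarith) (Nat.lt_floor_add_one K).le)
  have hsum := sum_invSqrtPow_div_log_le_add 1 (Nat.one_le_floor_iff K |>.2 hK.le) ⌊K ^ 2⌋₊
  calc _ ≤ Real.log K * (4 * √K + 2 * K / Real.log K) :=
        mul_le_mul_of_nonneg_left (by linarith) hlog.le
    _ = 4 * (Real.log K * √K) + 2 * K := by field_simp
    _ ≤ 10 * K := by nlinarith [Real.sqrt_nonneg K, Real.sq_sqrt hK0]

theorem one_sub_div_le_log_sub_log {x y : ℝ} (hx : 0 < x) (hy : 0 < y) :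
    1 - x / y ≤ Real.log y - Real.log x := by
  rw [← Real.log_div hy.ne' hx.ne', ← inv_div]
  exact Real.one_sub_inv_le_log_of_pos (div_pos hy hx)

theorem inv_div_log_le {x : ℝ} (hx : 1 < x) :
    x⁻¹ / Real.log (x + 1) ≤
      2 * (Real.log (Real.log (x + 1)) - Real.log (Real.log x)) := by
  have hx0 : 0 < x := by linarith
  have hlog : 0 < Real.log x := Real.log_pos hx
  have hlog' : 0 < Real.log (x + 1) := Real.log_pos (by linarith)
  have hinv : x⁻¹ ≤ 2 * (1 - x / (x + 1)) := by
    rw [one_sub_div (by linarith), inv_eq_one_div, ← mul_div_assoc,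
      div_le_div_iff₀ hx0 (by linarith)]
    linarith
  have hdiff := one_sub_div_le_log_sub_log hx0 (show 0 < x + 1 by linarith)
  calc x⁻¹ / Real.log (x + 1)
      ≤ 2 * (Real.log (x + 1) - Real.log x) / Real.log (x + 1) :=
        div_le_div_of_nonneg_right (by linarith) hlog'.le
    _ = 2 * (1 - Real.log x / Real.log (x + 1)) := by field_simp
    _ ≤ _ := mul_le_mul_of_nonneg_left (one_sub_div_le_log_sub_log hlog hlog') two_pos.le

theorem exists_sum_invSqrtPow_two_div_log_le : ∃ c : ℝ, 0 ≤ c ∧ ∀ N : ℕ, 1 ≤ N →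
    ∑ D ∈ Finset.Icc 1 N, invSqrtPow 2 D / Real.log (D + 1) ≤
      c + 2 * Real.log (Real.log (N + 1)) := by
  refine ⟨2 + 2 * |Real.log (Real.log 2)|, by positivity, fun N hN => ?_⟩
  induction N, hN using Nat.le_induction with
  | base =>
    have hbase := invSqrtPow_div_log_le 2 le_rfl
    have hone := invSqrtPow_le_one 2 one_pos
    rw [Nat.cast_one, one_add_one_eq_two] at hbase
    rw [Finset.Icc_self, Finset.sum_singleton, Nat.cast_one, one_add_one_eq_two]
    linarith [neg_abs_le (Real.log (Real.log 2))]
  | succ N hN ih =>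
    have hN0 : (0 : ℝ) < N := by exact_mod_cast hN
    have hstep := inv_div_log_le (show 1 < (N : ℝ) + 1 by linarith)
    rw [Finset.sum_Icc_succ_top (by omega), invSqrtPow, Real.sq_sqrt (Nat.cast_nonneg _),
      Nat.cast_add_one]
    linarith

/-! ### The five estimates -/

theorem log_mul_le_two_mul_log {c H : ℝ} (hc : 0 < c) (hcH : c ≤ H) :
    Real.log (c * H) ≤ 2 * Real.log H := by
  rw [Real.log_mul hc.ne' (hc.trans_le hcH).ne']
  linarith [Real.log_le_log hc hcH]

theorem log_log_floor_sq_add_one_le {K : ℝ} (hK : 2 ≤ K) :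
    Real.log (Real.log (⌊K ^ 2⌋₊ + 1)) ≤ 2 + Real.log (Real.log K) := by
  have hlogK : 0 < Real.log K := Real.log_pos (by linarith)
  have hfloor : (1 : ℝ) ≤ ⌊K ^ 2⌋₊ :=
    Nat.one_le_cast.2 ((Nat.one_le_floor_iff (K ^ 2)).2 (by nlinarith))
  have hcube : (⌊K ^ 2⌋₊ : ℝ) + 1 ≤ K ^ 3 := by
    nlinarith [Nat.floor_le (sq_nonneg K)]
  have hlog : Real.log (⌊K ^ 2⌋₊ + 1) ≤ 3 * Real.log K :=
    (Real.log_le_log (by linarith) hcube).trans_eq (by rw [Real.log_pow, Nat.cast_ofNat])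
  refine (Real.log_le_log (Real.log_pos (by linarith)) hlog).trans ?_
  rw [Real.log_mul three_ne_zero hlogK.ne']
  linarith [Real.log_le_sub_one_of_pos (zero_lt_three (α := ℝ))]

theorem isBigO_of_eventually_le {f g : ℝ → ℝ} {C : ℝ} (hf : ∀ H, 0 ≤ f H)
    (h : ∀ᶠ H in atTop, 0 ≤ g H ∧ f H ≤ C * g H) : f =O[atTop] g := by
  refine IsBigO.of_bound C ?_
  filter_upwards [h] with H hH
  rw [Real.norm_of_nonneg (hf H), Real.norm_of_nonneg hH.1]
  exact hH.2

theorem isBigO_ncard_galoisContainedSet_three :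
    (fun H : ℝ => ((galoisContainedSet (G3 3) H).ncard : ℝ))
      =O[atTop] fun H : ℝ => H ^ 2 * Real.log H ^ 2 := by
  obtain ⟨c, hc, hcount⟩ := exists_ncard_galoisContainedSet_le 1
  refine isBigO_of_eventually_le (C := 2916 * c ^ 2) (fun H => Nat.cast_nonneg _) ?_
  filter_upwards [eventually_ge_atTop c, Real.tendsto_log_atTop.eventually_ge_atTop 1]
    with H hcH hlog
  have hK : 1 ≤ c * H := one_le_mul_of_one_le_of_one_le hc (hc.trans hcH)
  refine ⟨by positivity, (hcount H).trans ?_⟩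
  have hints := sum_nonzeroInts_le (zero_le_one.trans hK) (invSqrtPow_nonneg 2)
  have hharm := sum_invSqrtPow_two_le hK
  have hlogK := log_mul_le_two_mul_log (zero_lt_one.trans_le hc) hcH
  have hsum : ∑ a ∈ nonzeroInts (c * H), invSqrtPow 2 a.natAbs ≤ 6 * Real.log H := by linarith
  calc _ ≤ (9 * (c * H)) ^ 2 * (6 * Real.log H) ^ 2 :=
        mul_le_mul_of_nonneg_left (pow_le_pow_left₀ (Finset.sum_nonneg fun _ _ =>
          invSqrtPow_nonneg _ _) hsum 2) (by positivity)
    _ = 2916 * c ^ 2 * (H ^ 2 * Real.log H ^ 2) := by ring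

theorem isBigO_ncard_galoisContainedSet {k : ℕ} (hk : 2 ≤ k) :
    (fun H : ℝ => ((galoisContainedSet (G3 (2 * k + 1)) H).ncard : ℝ))
      =O[atTop] fun H : ℝ => H ^ (k + 1) := by
  obtain ⟨c, hc, hcount⟩ := exists_ncard_galoisContainedSet_le k
  obtain ⟨e, -, hbounded⟩ := exists_sum_invSqrtPow_le
  refine isBigO_of_eventually_le (C := (9 * c) ^ (k + 1) * (2 * e) ^ 2)
    (fun H => Nat.cast_nonneg _) ?_
  filter_upwards [eventually_ge_atTop 0] with H hH
  have hK : 0 ≤ c * H := mul_nonneg (zero_le_one.trans hc) hH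
  refine ⟨by positivity, (hcount H).trans ?_⟩
  have hsum : ∑ a ∈ nonzeroInts (c * H), invSqrtPow (k + 1) a.natAbs ≤ 2 * e :=
    (sum_nonzeroInts_le hK (invSqrtPow_nonneg _)).trans
      (mul_le_mul_of_nonneg_left (hbounded (k + 1) (by omega) _) two_pos.le)
  calc _ ≤ (9 * (c * H)) ^ (k + 1) * (2 * e) ^ 2 :=
        mul_le_mul_of_nonneg_left (pow_le_pow_left₀ (Finset.sum_nonneg fun _ _ =>
          invSqrtPow_nonneg _ _) hsum 2) (by positivity)
    _ = (9 * c) ^ (k + 1) * (2 * e) ^ 2 * H ^ (k + 1) := by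
        rw [← mul_assoc, mul_pow (9 * c), mul_right_comm]

theorem isBigO_ncard_monic_galoisContainedSet_three :
    (fun H : ℝ => ({f ∈ galoisContainedSet (G3 3) H | f.Monic}.ncard : ℝ))
      =O[atTop] fun H : ℝ => H ^ 2 := by
  obtain ⟨c, hc, hcount⟩ := exists_ncard_monic_galoisContainedSet_le 1
  refine isBigO_of_eventually_le (C := 77841 * c ^ 2) (fun H => Nat.cast_nonneg _) ?_
  filter_upwards [eventually_ge_atTop 3] with H hH
  have hK : 3 ≤ c * H := by nlinarith
  refine ⟨by positivity, (hcount H).trans ?_⟩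
  have hquad := sum_quadruples_le 1 (show 1 ≤ c * H by linarith)
  have hsqrt : √(⌊c * H⌋₊ : ℝ) ≤ c * H :=
    (Real.sqrt_le_sqrt (Nat.floor_le (by linarith))).trans
      ((Real.sqrt_le_left (by linarith)).2 (by nlinarith))
  have hone := sum_invSqrtPow_one_le ⌊c * H⌋₊
  have hpell := log_mul_sum_invSqrtPow_one_div_log_le (show 1 < c * H by linarith)
  have hlog := log_mul_le_two_mul_log three_pos hK
  set S := ∑ D ∈ Finset.Icc 1 ⌊(c * H) ^ 2⌋₊, invSqrtPow 1 D / Real.log (D + 1)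
  have hS : 0 ≤ S := Finset.sum_nonneg fun D _ => invSqrtPow_div_log_nonneg 1 D
  have hlogS : Real.log (3 * (c * H)) * S ≤ 2 * Real.log (c * H) * S :=
    mul_le_mul_of_nonneg_right hlog hS
  calc _ ≤ (9 * (c * H)) ^ 1 * (8649 * (c * H)) :=
        mul_le_mul_of_nonneg_left (by linarith) (by positivity)
    _ = 77841 * c ^ 2 * H ^ 2 := by ring

theorem isBigO_ncard_monic_galoisContainedSet_five :
    (fun H : ℝ => ({f ∈ galoisContainedSet (G3 5) H | f.Monic}.ncard : ℝ))
      =O[atTop] fun H : ℝ => H ^ 2 * Real.log H * Real.log (Real.log H) := by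
  obtain ⟨c, hc, hcount⟩ := exists_ncard_monic_galoisContainedSet_le 2
  obtain ⟨e, he, hpell⟩ := exists_sum_invSqrtPow_two_div_log_le
  refine isBigO_of_eventually_le (C := 81 * c ^ 2 * (7533 + 288 * (e + 8)))
    (fun H => Nat.cast_nonneg _) ?_
  filter_upwards [eventually_ge_atTop 3, eventually_ge_atTop c,
    Real.tendsto_log_atTop.eventually_ge_atTop 1,
    (Real.tendsto_log_atTop.comp Real.tendsto_log_atTop).eventually_ge_atTop 1]
    with H hH hcH hlog (hloglog : 1 ≤ Real.log (Real.log H))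
  have hK : 3 ≤ c * H := by nlinarith
  refine ⟨by positivity, (hcount H).trans ?_⟩
  have hquad := sum_quadruples_le 2 (show 1 ≤ c * H by linarith)
  have hharm := sum_invSqrtPow_two_le (show 1 ≤ c * H by linarith)
  have hlogK := log_mul_le_two_mul_log (zero_lt_one.trans_le hc) hcH
  have hlog3K := log_mul_le_two_mul_log three_pos hK
  have hloglogK : Real.log (Real.log (c * H)) ≤ 1 + Real.log (Real.log H) := by
    refine (Real.log_le_log (Real.log_pos (by linarith)) hlogK).trans ?_
    rw [Real.log_mul two_ne_zero (by linarith)]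
    linarith [Real.log_le_sub_one_of_pos (zero_lt_two (α := ℝ))]
  have hfloor := log_log_floor_sq_add_one_le (show 2 ≤ c * H by linarith)
  have hS := hpell _ ((Nat.one_le_floor_iff ((c * H) ^ 2)).2 (by nlinarith))
  set S := ∑ D ∈ Finset.Icc 1 ⌊(c * H) ^ 2⌋₊, invSqrtPow 2 D / Real.log (D + 1)
  have hS0 : 0 ≤ S := Finset.sum_nonneg fun D _ => invSqrtPow_div_log_nonneg 2 D
  have hprod : Real.log (3 * (c * H)) * S ≤
      4 * Real.log H * ((e + 8) * Real.log (Real.log H)) :=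
    mul_le_mul (by linarith) (by nlinarith) hS0 (by linarith)
  have hlog_le : Real.log H ≤ Real.log H * Real.log (Real.log H) :=
    le_mul_of_one_le_right (by linarith) hloglog
  calc _ ≤ (9 * (c * H)) ^ 2 *
        ((7533 + 288 * (e + 8)) * (Real.log H * Real.log (Real.log H))) :=
        mul_le_mul_of_nonneg_left (by linarith) (by positivity)
    _ = 81 * c ^ 2 * (7533 + 288 * (e + 8)) *
        (H ^ 2 * Real.log H * Real.log (Real.log H)) := by ring

theorem isBigO_ncard_monic_galoisContainedSet {k : ℕ} (hk : 3 ≤ k) :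
    (fun H : ℝ => ({f ∈ galoisContainedSet (G3 (2 * k + 1)) H | f.Monic}.ncard : ℝ))
      =O[atTop] fun H : ℝ => H ^ k * Real.log H := by
  obtain ⟨c, hc, hcount⟩ := exists_ncard_monic_galoisContainedSet_le k
  obtain ⟨e, he, hbounded⟩ := exists_sum_invSqrtPow_le
  refine isBigO_of_eventually_le (C := (9 * c) ^ k * (6561 + 900 * e))
    (fun H => Nat.cast_nonneg _) ?_
  filter_upwards [eventually_ge_atTop 3, eventually_ge_atTop c,
    Real.tendsto_log_atTop.eventually_ge_atTop 1] with H hH hcH hlog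
  have hK : 3 ≤ c * H := by nlinarith
  refine ⟨by positivity, (hcount H).trans ?_⟩
  have hquad := sum_quadruples_le k (show 1 ≤ c * H by linarith)
  have hsum := hbounded k hk ⌊c * H⌋₊
  have hlogK := log_mul_le_two_mul_log (zero_lt_one.trans_le hc) hcH
  have hlog3K := log_mul_le_two_mul_log three_pos hK
  have hS := sum_invSqrtPow_div_log_le k ⌊(c * H) ^ 2⌋₊
  have hsum' := hbounded k hk ⌊(c * H) ^ 2⌋₊
  have hprod : Real.log (3 * (c * H)) * ∑ D ∈ Finset.Icc 1 ⌊(c * H) ^ 2⌋₊,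
      invSqrtPow k D / Real.log (D + 1) ≤ 4 * Real.log H * (2 * e) :=
    mul_le_mul (by linarith) (by linarith)
      (Finset.sum_nonneg fun D _ => invSqrtPow_div_log_nonneg k D) (by linarith)
  have helog : e ≤ e * Real.log H := le_mul_of_one_le_right he hlog
  calc _ ≤ (9 * (c * H)) ^ k * ((6561 + 900 * e) * Real.log H) :=
        mul_le_mul_of_nonneg_left (by linarith) (by positivity)
    _ = (9 * c) ^ k * (6561 + 900 * e) * (H ^ k * Real.log H) := by
        rw [← mul_assoc 9, mul_pow (9 * c)]
        ring

theorem isBigO_ncard_of_subset {S T : ℝ → Set ℤ[X]} (hST : ∀ H, S H ⊆ T H)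
    (hT : ∀ H, (T H).Finite) {g : ℝ → ℝ} (h : (fun H => ((T H).ncard : ℝ)) =O[atTop] g) :
    (fun H => ((S H).ncard : ℝ)) =O[atTop] g := by
  refine (IsBigO.of_norm_le fun H => ?_).trans h
  rw [Real.norm_natCast, Nat.cast_le]
  exact Set.ncard_le_ncard (hST H) (hT H)

theorem exceptionalSet_subset_galoisContainedSet {n : ℕ} (G : Subgroup (Wreath n)) (H : ℝ) :
    exceptionalSet G H ⊆ galoisContainedSet G H :=
  fun _ ⟨hdeg, _, hsep, hbound, _, hG⟩ => ⟨hdeg, hsep, hbound, hG⟩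

theorem isBigO_countE {n : ℕ} (hodd : Odd n) {g : ℝ → ℝ}
    (h : (fun H : ℝ => ((galoisContainedSet (G3 n) H).ncard : ℝ)) =O[atTop] g) :
    (fun H : ℝ => (countE (G3 n) H : ℝ)) =O[atTop] g := by
  obtain ⟨k, rfl⟩ := hodd
  exact isBigO_ncard_of_subset (fun H => exceptionalSet_subset_galoisContainedSet _ H)
    (fun H => finite_galoisContainedSet k H) h

theorem isBigO_countEMonic {n : ℕ} (hodd : Odd n) {g : ℝ → ℝ}
    (h : (fun H : ℝ => ({f ∈ galoisContainedSet (G3 n) H | f.Monic}.ncard : ℝ)) =O[atTop] g) :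
    (fun H : ℝ => (countEMonic (G3 n) H : ℝ)) =O[atTop] g := by
  obtain ⟨k, rfl⟩ := hodd
  exact isBigO_ncard_of_subset (T := fun H => {f ∈ galoisContainedSet (G3 (2 * k + 1)) H | f.Monic})
    (fun H _ hf => ⟨exceptionalSet_subset_galoisContainedSet _ H hf.1, hf.2⟩)
    (fun H => (finite_galoisContainedSet k H).subset (Set.sep_subset _ _)) h

end ReciprocalGalois

theorem mainTheorem7_general (n : ℕ) (hodd : Odd n) :
    ((n = 3 →
        (fun H : ℝ =>
          ((ReciprocalGalois.galoisContainedSet (ReciprocalGalois.G3 n) H).ncard : ℝ))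
          =O[atTop] fun H : ℝ => H ^ 2 * Real.log H ^ 2) ∧
      (5 ≤ n →
        (fun H : ℝ =>
          ((ReciprocalGalois.galoisContainedSet (ReciprocalGalois.G3 n) H).ncard : ℝ))
          =O[atTop] fun H : ℝ => H ^ ((n + 1) / 2))) ∧
    ((n = 3 →
        (fun H : ℝ => ({f ∈ ReciprocalGalois.galoisContainedSet (ReciprocalGalois.G3 n) H |
          f.Monic}.ncard : ℝ))
          =O[atTop] fun H : ℝ => H ^ 2) ∧
      (n = 5 →
        (fun H : ℝ => ({f ∈ ReciprocalGalois.galoisContainedSet (ReciprocalGalois.G3 n) H |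
          f.Monic}.ncard : ℝ))
          =O[atTop] fun H : ℝ => H ^ 2 * Real.log H * Real.log (Real.log H)) ∧
      (7 ≤ n →
        (fun H : ℝ => ({f ∈ ReciprocalGalois.galoisContainedSet (ReciprocalGalois.G3 n) H |
          f.Monic}.ncard : ℝ))
          =O[atTop] fun H : ℝ => H ^ ((n - 1) / 2) * Real.log H)) := by
  refine ⟨⟨?_, ?_⟩, ?_, ?_, ?_⟩
  · rintro rfl
    exact ReciprocalGalois.isBigO_ncard_galoisContainedSet_three
  · obtain ⟨k, rfl⟩ := hodd
    intro h5
    rw [show (2 * k + 1 + 1) / 2 = k + 1 by omega]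
    exact ReciprocalGalois.isBigO_ncard_galoisContainedSet (by omega)
  · rintro rfl
    exact ReciprocalGalois.isBigO_ncard_monic_galoisContainedSet_three
  · rintro rfl
    exact ReciprocalGalois.isBigO_ncard_monic_galoisContainedSet_five
  · obtain ⟨k, rfl⟩ := hodd
    intro h7
    rw [show (2 * k + 1 - 1) / 2 = k by omega]
    exact ReciprocalGalois.isBigO_ncard_monic_galoisContainedSet (by omega)

/-- Since `n` is odd, the exponents `(n + 1) / 2` and `(n - 1) / 2` are exact divisions. -/
theorem mainTheorem7 (n : ℕ) (hn : 3 ≤ n) (hodd : Odd n) :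
    ((n = 3 →
        (fun H : ℝ => (ReciprocalGalois.countE (ReciprocalGalois.G3 n) H : ℝ))
          =O[atTop] fun H : ℝ => H ^ 2 * Real.log H ^ 2) ∧
      (5 ≤ n →
        (fun H : ℝ => (ReciprocalGalois.countE (ReciprocalGalois.G3 n) H : ℝ))
          =O[atTop] fun H : ℝ => H ^ ((n + 1) / 2))) ∧
    ((n = 3 →
        (fun H : ℝ => (ReciprocalGalois.countEMonic (ReciprocalGalois.G3 n) H : ℝ))
          =O[atTop] fun H : ℝ => H ^ 2) ∧
      (n = 5 →
        (fun H : ℝ => (ReciprocalGalois.countEMonic (ReciprocalGalois.G3 n) H : ℝ))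
          =O[atTop] fun H : ℝ => H ^ 2 * Real.log H * Real.log (Real.log H)) ∧
      (7 ≤ n →
        (fun H : ℝ => (ReciprocalGalois.countEMonic (ReciprocalGalois.G3 n) H : ℝ))
          =O[atTop] fun H : ℝ => H ^ ((n - 1) / 2) * Real.log H)) := by
  obtain ⟨⟨h3, h5⟩, h3', h5', h7'⟩ := mainTheorem7_general n hodd
  exact ⟨⟨fun h => ReciprocalGalois.isBigO_countE hodd (h3 h),
    fun h => ReciprocalGalois.isBigO_countE hodd (h5 h)⟩,
    fun h => ReciprocalGalois.isBigO_countEMonic hodd (h3' h),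
    fun h => ReciprocalGalois.isBigO_countEMonic hodd (h5' h),
    fun h => ReciprocalGalois.isBigO_countEMonic hodd (h7' h)⟩
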